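/- All graphs are finite and simple. A \emph{2-edge-colored graph} is a graph each of whose edges is assigned exactly one of two colors; no further condition is imposed on the coloring. A \emph{cycle} of such a graph is a subgraph that is the empty graph, a single vertex, a single edge together with its two endpoints, or a usual cycle of length at least $3$. A cycle is \emph{monochromatic} if all of its edges have the same color (so the empty graph, a single vertex, and a single edge are always monochromatic). The \emph{independence number} $\alpha(G)$ is the maximum number of pairwise non-adjacent vertices of $G$. \textbf{Theorem.} For every real number $\eta>0$ and every positive integer $\alpha$ there exists $n_0=n_0(\eta,\alpha)$ such that the following holds. If $G$ is a 2-edge-colored graph on $n\ge n_0$ vertices with $\alpha(G)=\alpha$, then there are at most $2\alpha$ pairwise vertex-disjoint monochromatic cycles of $G$ that together cover at least $(1-\eta)n$ vertices of $G$. -/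

import Mathlib

namespace SimpleGraph

variable {V : Type*} {G : SimpleGraph V}

/-- The subgraph `C` is a cycle in the wide sense that is customary for cycle partitions: the empty
graph, a single vertex, a single edge with its two ends, or a genuine cycle (of length at least
three). -/
def Subgraph.IsCycleSubgraph (C : G.Subgraph) : Prop :=
  C = ⊥ ∨
  (∃ v : V, C = G.singletonSubgraph v) ∨
  (∃ (u v : V) (h : G.Adj u v), C = G.subgraphOfAdj h) ∨
  (∃ (v : V) (p : G.Walk v v), p.IsCycle ∧ C = p.toSubgraph)

/-- All edges of the subgraph `C` have the same color in the edge coloring `χ` of `G`; a subgraph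
without edges is monochromatic in any color. -/
def Subgraph.IsMonochromatic {K : Type*} (χ : G.EdgeLabeling K) (C : G.Subgraph) : Prop :=
  ∃ c : K, ∀ (e : Sym2 V) (he : e ∈ C.edgeSet), χ ⟨e, C.edgeSet_subset he⟩ = c

end SimpleGraph

/-!
A colour class of `G` falls into highly connected pieces once few vertices and few edges are given
up (`exists_decomposition`): as long as a set is separated by a small set of vertices it is cut
there. View the vertices as points of a grid whose rows are the red and whose columns are the blue
pieces: two vertices that share neither row nor column are non-adjacent, up to the edges given up.
A bounded branching search, each step of which avoids those edges, together with König's theorem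
yields at most `α` pieces that cover almost all vertices (`exists_label_cover`). No bound on the number of pieces enters here,
so the number of edges given up may be chosen in terms of `η` and `α` alone.

Long monochromatic paths are packed greedily into these pieces. What remains has few edges inside
them, so an edge between remaining vertices typically lies in a piece that was not chosen. Of the
two pieces of a remaining vertex at least one was chosen, hence the other one serves as a label that
is constant along almost all edges, and again at most `α` labels, that is, at most `α` further
pieces, cover almost all of the remaining vertices. After paths have been packed into these pieces
too, the remainder has few edges altogether, and is small because its independence number is at most
`α` (`exists_path_packing`).

The paths have linear length, so their number is bounded. Before they are chosen, a bounded number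
of disjoint connected sets of bounded size is reserved in every piece, each of which has neighbours
of almost all vertices of the piece (`exists_small_connected`). Each of them joins two path ends, so
that all paths in one piece become a single cycle (`exists_cycle_through_paths`). This gives at most
`2 * α` cycles.
-/

namespace MonochromaticCover

open Finset
open scoped Classical

/-! ### Covering by label classes -/

/-- Hall's theorem, applied to one side of a minimum cover: the lines of that side are matched
to points which the other side misses. -/
theorem exists_matching_of_minimal_cover {V ρ κ : Type*} {S : Finset V} {r : V → ρ} {b : V → κ}
    {A : Finset ρ} {B : Finset κ} (hcov : ∀ v ∈ S, r v ∈ A ∨ b v ∈ B)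
    (hmin : ∀ (A' : Finset ρ) (B' : Finset κ), (∀ v ∈ S, r v ∈ A' ∨ b v ∈ B') →
      #A + #B ≤ #A' + #B') :
    ∃ p : A → V, (∀ x, p x ∈ S ∧ r (p x) = x ∧ b (p x) ∉ B) ∧
      Function.Injective fun x => b (p x) := by
  have hall := (Finset.all_card_le_biUnion_card_iff_exists_injective
    (fun x : A => (S.filter fun v => r v = x ∧ b v ∉ B).image b)).1 (by
      intro s
      by_contra! hlt
      -- a violation of Hall's condition would allow trading `s` for its neighbourhood
      have h := hmin (A \ s.map (Function.Embedding.subtype _))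
        (B ∪ s.biUnion fun x : A => (S.filter fun v => r v = x ∧ b v ∉ B).image b) (by
          intro v hv
          by_cases hB : b v ∈ B
          · exact Or.inr (mem_union_left _ hB)
          have hA := (hcov v hv).resolve_right hB
          by_cases hs : (⟨r v, hA⟩ : A) ∈ s
          · refine Or.inr (mem_union_right _ (mem_biUnion.2 ⟨_, hs, mem_image.2 ⟨v, ?_, rfl⟩⟩))
            simp [hv, hB]
          · refine Or.inl (mem_sdiff.2 ⟨hA, ?_⟩)
            simp [hA, hs])
      have h1 : #(A \ s.map (Function.Embedding.subtype _)) = #A - #s := by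
        rw [card_sdiff_of_subset, card_map]
        intro x hx
        obtain ⟨y, -, rfl⟩ := mem_map.1 hx
        exact y.2
      have h2 : #s ≤ #A := by simpa using card_le_univ s
      have h3 := card_union_le B
        (s.biUnion fun x : A => (S.filter fun v => r v = x ∧ b v ∉ B).image b)
      omega)
  obtain ⟨f, hf, hmem⟩ := hall
  have hp : ∀ x : A, ∃ v ∈ S, r v = x ∧ b v ∉ B ∧ b v = f x := by
    intro x
    obtain ⟨v, hv, hvf⟩ := mem_image.1 (hmem x)
    simp only [mem_filter] at hv
    exact ⟨v, hv.1, hv.2.1, hv.2.2, hvf⟩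
  choose p hpS hpr hpB hpf using hp
  refine ⟨p, fun x => ⟨hpS x, hpr x, hpB x⟩, fun x y hxy => hf ?_⟩
  simpa [hpf] using hxy

/-- König's theorem for a set `S` of points, each of which lies on the row `r v` and on the
column `b v`: if `m` lines never cover `S`, then `S` has more than `m` points no two of which
share a line. -/
theorem exists_transversal_of_not_coverable {V ρ κ : Type*} {S : Finset V} {r : V → ρ}
    {b : V → κ} {m : ℕ} (h : ∀ (A : Finset ρ) (B : Finset κ),
      (∀ v ∈ S, r v ∈ A ∨ b v ∈ B) → m < #A + #B) :
    ∃ T ⊆ S, m < #T ∧ Set.InjOn r T ∧ Set.InjOn b T := by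
  obtain ⟨⟨A, B⟩, hcov, hmin⟩ : ∃ C : Finset ρ × Finset κ,
      (∀ v ∈ S, r v ∈ C.1 ∨ b v ∈ C.2) ∧ ∀ C' : Finset ρ × Finset κ,
        (∀ v ∈ S, r v ∈ C'.1 ∨ b v ∈ C'.2) → #C.1 + #C.2 ≤ #C'.1 + #C'.2 := by
    let P : ℕ → Prop := fun k => ∃ C : Finset ρ × Finset κ,
      (∀ v ∈ S, r v ∈ C.1 ∨ b v ∈ C.2) ∧ #C.1 + #C.2 = k
    have hP : ∃ k, P k := ⟨_, (S.image r, ∅), fun v hv => Or.inl (mem_image_of_mem _ hv), rfl⟩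
    obtain ⟨C, hC, hk⟩ := Nat.find_spec hP
    exact ⟨C, hC, fun C' hC' => hk ▸ Nat.find_min' hP ⟨C', hC', rfl⟩⟩
  obtain ⟨p, hp, hpinj⟩ := exists_matching_of_minimal_cover hcov
    fun A' B' h' => hmin (A', B') h'
  obtain ⟨q, hq, hqinj⟩ := exists_matching_of_minimal_cover (r := b) (b := r) (A := B) (B := A)
    (fun v hv => (hcov v hv).symm) fun B' A' h' => by
      have := hmin (A', B') fun v hv => (h' v hv).symm
      simp only at this
      omega
  have hrinj : Function.Injective fun x => r (p x) := fun x y hxy =>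
    Subtype.ext (by simpa [hp] using hxy)
  have hbinj : Function.Injective fun x => b (q x) := fun x y hxy =>
    Subtype.ext (by simpa [hq] using hxy)
  refine ⟨univ.image p ∪ univ.image q, ?_, ?_, ?_, ?_⟩
  · intro v hv
    simp only [mem_union, mem_image, mem_univ, true_and] at hv
    rcases hv with ⟨x, rfl⟩ | ⟨x, rfl⟩
    exacts [(hp x).1, (hq x).1]
  · rw [card_union_of_disjoint, card_image_of_injective, card_image_of_injective]
    · simpa using h A B hcov
    · exact fun x y hxy => hbinj (congrArg b hxy)
    · exact fun x y hxy => hrinj (congrArg r hxy)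
    · rw [disjoint_left]
      simp only [mem_image, mem_univ, true_and, not_exists]
      rintro _ ⟨x, rfl⟩ y hy
      have := (hq y).2.2
      rw [hy, (hp x).2.1] at this
      exact this x.2
  · intro v hv w hw hvw
    simp only [coe_union, coe_image, coe_univ, Set.image_univ, Set.mem_union,
      Set.mem_range] at hv hw
    rcases hv with ⟨x, rfl⟩ | ⟨x, rfl⟩ <;> rcases hw with ⟨y, rfl⟩ | ⟨y, rfl⟩
    · exact congrArg p (hrinj hvw)
    · exact absurd x.2 (by have := (hq y).2.2; rwa [← hvw, (hp x).2.1] at this)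
    · exact absurd y.2 (by have := (hq x).2.2; rwa [hvw, (hp y).2.1] at this)
    · exact congrArg q (hqinj hvw)
  · intro v hv w hw hvw
    simp only [coe_union, coe_image, coe_univ, Set.image_univ, Set.mem_union,
      Set.mem_range] at hv hw
    rcases hv with ⟨x, rfl⟩ | ⟨x, rfl⟩ <;> rcases hw with ⟨y, rfl⟩ | ⟨y, rfl⟩
    · exact congrArg p (hpinj hvw)
    · exact absurd y.2 (by have := (hp x).2.2; rwa [hvw, (hq y).2.1] at this)
    · exact absurd x.2 (by have := (hp y).2.2; rwa [← hvw, (hq x).2.1] at this)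
    · exact congrArg q (hbinj hvw)

/-- If too many points are uncovered, one of them has no bad partner in `Z`. -/
theorem exists_free_point {V ρ κ : Type*} {S : Finset V} {r : V → ρ} {b : V → κ}
    {bad : V → V → Prop} {e N : ℕ} (hbad : ∀ u ∈ S, #{v ∈ S | bad u v} ≤ e) {Z : Finset V}
    (hZS : Z ⊆ S) (hZ : #Z ≤ N) {I : Finset ρ} {J : Finset κ}
    (hU : ¬ #{v ∈ S | r v ∉ I ∧ b v ∉ J} ≤ N * e) :
    ∃ p ∈ S, r p ∉ I ∧ b p ∉ J ∧ ∀ u ∈ Z, ¬ bad u p := by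
  have h1 : #(Z.biUnion fun u => {v ∈ S | bad u v}) ≤ #Z * e :=
    card_biUnion_le_card_mul _ _ _ fun u hu => hbad u (hZS hu)
  have h2 : #Z * e ≤ N * e := Nat.mul_le_mul_right _ hZ
  obtain ⟨p, hp, hpZ⟩ := exists_mem_notMem_of_card_lt_card (h1.trans_lt (h2.trans_lt (not_le.1 hU)))
  simp only [mem_filter] at hp
  refine ⟨p, hp.1, hp.2.1, hp.2.2, fun u hu hb => hpZ (mem_biUnion.2 ⟨u, hu, ?_⟩)⟩
  simp [hp.1, hb]

/-- The branching search for a small cover. Either the lines `I`, `J` extend by at most `m` lines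
to a cover of all but `2 ^ (M + 1) * e` points, or there are few points, with no bad pair among
them or with the points of `Z`, that cannot be covered by `m` lines. A step takes an uncovered
point without bad partners and branches over the two lines through it; the points collected in
both branches stay uncoverable with one line more. -/
theorem exists_extension_or_uncoverable {V ρ κ : Type*} {S : Finset V} {r : V → ρ} {b : V → κ}
    {bad : V → V → Prop} (hsymm : ∀ u v, bad u v → bad v u) {e : ℕ}
    (hbad : ∀ u ∈ S, #{v ∈ S | bad u v} ≤ e) (M m : ℕ)
    (Z : Finset V) (hZS : Z ⊆ S) (hZ : #Z + 2 ^ (m + 1) ≤ 2 ^ (M + 1))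
    (I : Finset ρ) (J : Finset κ) :
    (∃ (I' : Finset ρ) (J' : Finset κ), #I' + #J' ≤ #I + #J + m ∧
      #{v ∈ S | r v ∉ I' ∧ b v ∉ J'} ≤ 2 ^ (M + 1) * e) ∨
    ∃ T ⊆ S, #T + 1 ≤ 2 ^ (m + 1) ∧ (∀ v ∈ T, r v ∉ I ∧ b v ∉ J) ∧
      (∀ u ∈ Z, ∀ v ∈ T, ¬ bad u v) ∧ (∀ u ∈ T, ∀ v ∈ T, u ≠ v → ¬ bad u v) ∧
      ∀ (A : Finset ρ) (B : Finset κ), (∀ v ∈ T, r v ∈ A ∨ b v ∈ B) → m < #A + #B := by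
  induction m generalizing Z I J with
  | zero =>
    by_cases hU : #{v ∈ S | r v ∉ I ∧ b v ∉ J} ≤ 2 ^ (M + 1) * e
    · exact Or.inl ⟨I, J, le_rfl, hU⟩
    obtain ⟨p, hpS, hpI, hpJ, hpZ⟩ := exists_free_point (N := 2 ^ (M + 1)) hbad hZS (by omega) hU
    refine Or.inr ⟨{p}, by simpa using hpS, by simp, by simp [hpI, hpJ], by simpa using hpZ,
      by simp, fun A B h => ?_⟩
    rcases h p (by simp) with h | h
    · have := card_pos.2 ⟨_, h⟩
      omega
    · have := card_pos.2 ⟨_, h⟩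
      omega
  | succ m ih =>
    have hpow : 2 ^ (m + 1 + 1) = 2 * 2 ^ (m + 1) := by ring
    have hpos : 0 < 2 ^ (m + 1) := by positivity
    by_cases hU : #{v ∈ S | r v ∉ I ∧ b v ∉ J} ≤ 2 ^ (M + 1) * e
    · exact Or.inl ⟨I, J, by omega, hU⟩
    obtain ⟨p, hpS, hpI, hpJ, hpZ⟩ := exists_free_point (N := 2 ^ (M + 1)) hbad hZS (by omega) hU
    have hc1 := card_insert_le p Z
    have hI := card_insert_le (r p) I
    have hJ := card_insert_le (b p) J
    rcases ih (insert p Z) (insert_subset hpS hZS) (by omega) (insert (r p) I) J with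
      ⟨I', J', hIJ, hle⟩ | ⟨T₁, hT₁S, hT₁c, hT₁l, hT₁Z, hT₁b, hT₁⟩
    · exact Or.inl ⟨I', J', by omega, hle⟩
    have hc2 := card_union_le (insert p Z) T₁
    rcases ih (insert p Z ∪ T₁) (union_subset (insert_subset hpS hZS) hT₁S) (by omega) I
      (insert (b p) J) with ⟨I', J', hIJ, hle⟩ | ⟨T₂, hT₂S, hT₂c, hT₂l, hT₂Z, hT₂b, hT₂⟩
    · exact Or.inl ⟨I', J', by omega, hle⟩
    have hc3 := card_insert_le p (T₁ ∪ T₂)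
    have hc4 := card_union_le T₁ T₂
    refine Or.inr ⟨insert p (T₁ ∪ T₂), insert_subset hpS (union_subset hT₁S hT₂S), by omega,
      ?_, ?_, ?_, ?_⟩
    · intro v hv
      simp only [mem_insert, mem_union] at hv
      rcases hv with rfl | hv | hv
      · exact ⟨hpI, hpJ⟩
      · exact ⟨fun h => (hT₁l v hv).1 (mem_insert_of_mem h), (hT₁l v hv).2⟩
      · exact ⟨(hT₂l v hv).1, fun h => (hT₂l v hv).2 (mem_insert_of_mem h)⟩
    · intro u hu v hv
      simp only [mem_insert, mem_union] at hv
      rcases hv with rfl | hv | hv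
      · exact hpZ u hu
      · exact hT₁Z u (mem_insert_of_mem hu) v hv
      · exact hT₂Z u (mem_union_left _ (mem_insert_of_mem hu)) v hv
    · have hp1 : ∀ v ∈ T₁, ¬ bad p v := hT₁Z p (mem_insert_self _ _)
      have hp2 : ∀ v ∈ T₂, ¬ bad p v := hT₂Z p (mem_union_left _ (mem_insert_self _ _))
      have h12 : ∀ u ∈ T₁, ∀ v ∈ T₂, ¬ bad u v := fun u hu => hT₂Z u (mem_union_right _ hu)
      intro u hu v hv huv
      simp only [mem_insert, mem_union] at hu hv
      rcases hu with rfl | hu | hu <;> rcases hv with rfl | hv | hv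
      · exact absurd rfl huv
      · exact hp1 v hv
      · exact hp2 v hv
      · exact fun h => hp1 u hu (hsymm _ _ h)
      · exact hT₁b u hu v hv huv
      · exact h12 u hu v hv
      · exact fun h => hp2 u hu (hsymm _ _ h)
      · exact fun h => h12 v hv u hu (hsymm _ _ h)
      · exact hT₂b u hu v hv huv
    · intro A B h
      rcases h p (mem_insert_self _ _) with hp | hp
      · have := hT₁ (A.erase (r p)) B fun v hv => by
          have hne : r v ≠ r p := fun h => (hT₁l v hv).1 (h ▸ mem_insert_self _ _)
          rcases h v (mem_insert_of_mem (mem_union_left _ hv)) with h | h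
          exacts [Or.inl (mem_erase.2 ⟨hne, h⟩), Or.inr h]
        have hA := card_erase_add_one hp
        omega
      · have := hT₂ A (B.erase (b p)) fun v hv => by
          have hne : b v ≠ b p := fun h => (hT₂l v hv).2 (h ▸ mem_insert_self _ _)
          rcases h v (mem_insert_of_mem (mem_union_right _ hv)) with h | h
          exacts [Or.inl h, Or.inr (mem_erase.2 ⟨hne, h⟩)]
        have hB := card_erase_add_one hp
        omega

/-- If independent subsets of `S` have at most `α` vertices and almost all edges at each vertex join
it to vertices with which it shares one of its two labels, then at most `α` labels cover almost all
of `S`. -/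
theorem exists_label_cover {V ρ κ : Type*} [DecidableEq ρ] [DecidableEq κ] {G : SimpleGraph V} {S : Finset V} {α e : ℕ}
    (hα : ∀ T ⊆ S, G.IsIndepSet (T : Set V) → #T ≤ α) (r : V → ρ) (b : V → κ)
    (he : ∀ u ∈ S, #{v ∈ S | G.Adj u v ∧ r u ≠ r v ∧ b u ≠ b v} ≤ e) :
    ∃ (I : Finset ρ) (J : Finset κ), #I + #J ≤ α ∧
      #{v ∈ S | r v ∉ I ∧ b v ∉ J} ≤ 2 ^ (α + 1) * e := by
  rcases exists_extension_or_uncoverable (r := r) (b := b)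
    (bad := fun u v => G.Adj u v ∧ r u ≠ r v ∧ b u ≠ b v)
    (fun u v h => ⟨h.1.symm, h.2.1.symm, h.2.2.symm⟩) (S := S) (e := e)
    (fun u hu => by convert he u hu) α α ∅ (empty_subset _) (by simp) ∅ ∅ with
    ⟨I, J, hIJ, h⟩ | ⟨T, hTS, -, -, -, hTb, hT⟩
  · exact ⟨I, J, by simpa using hIJ, by convert h⟩
  obtain ⟨T', hT'T, hcard, hr, hb⟩ := exists_transversal_of_not_coverable hT
  refine absurd (hα T' (hT'T.trans hTS) fun u hu v hv huv hadj => ?_) (by omega)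
  exact hTb u (hT'T hu) v (hT'T hv) huv ⟨hadj, fun h => huv (hr hu hv h), fun h => huv (hb hu hv h)⟩

/-- The case of `exists_label_cover` in which both labels of a vertex are the same. -/
theorem exists_single_label_cover {V κ : Type*} [DecidableEq κ] {G : SimpleGraph V} {S : Finset V} {α e : ℕ}
    (hα : ∀ T ⊆ S, G.IsIndepSet (T : Set V) → #T ≤ α) (l : V → κ)
    (he : ∀ u ∈ S, #{v ∈ S | G.Adj u v ∧ l u ≠ l v} ≤ e) :
    ∃ Λ : Finset κ, #Λ ≤ α ∧ #{v ∈ S | l v ∉ Λ} ≤ 2 ^ (α + 1) * e := by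
  obtain ⟨I, J, hIJ, h⟩ := exists_label_cover hα l l fun u hu =>
    (card_le_card fun v hv => by simpa using hv).trans (he u hu)
  refine ⟨I ∪ J, ?_, (card_le_card fun v hv => ?_).trans h⟩
  · convert (card_union_le _ _).trans hIJ
  · simpa using hv

/-- A set on which `G` has small degrees and small independence number is small. -/
theorem card_le_of_degree_le {V : Type*} {G : SimpleGraph V} {S : Finset V} {α e : ℕ}
    (hα : ∀ T ⊆ S, G.IsIndepSet (T : Set V) → #T ≤ α)
    (he : ∀ u ∈ S, #{v ∈ S | G.Adj u v} ≤ e) : #S ≤ 2 ^ (α + 1) * e + α := by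
  obtain ⟨Λ, hΛ, h⟩ := exists_single_label_cover (l := id) hα fun u hu =>
    (card_le_card (monotone_filter_right _ fun v _ h => h.1)).trans (he u hu)
  have h1 : S ⊆ {v ∈ S | id v ∉ Λ} ∪ Λ := fun v hv => by
    by_cases hvΛ : v ∈ Λ <;> simp [hv, hvΛ]
  have h2 := card_le_card h1
  have h3 := card_union_le {v ∈ S | id v ∉ Λ} Λ
  omega

/-! ### Counting adjacent pairs -/

/-- The number of ordered pairs of elements of `L` that are related by `R`. -/
noncomputable def pairCount {V : Type*} (R : V → V → Prop) (L : Finset V) : ℕ :=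
  #{p ∈ L ×ˢ L | R p.1 p.2}

theorem pairCount_le_sdiff_add {V : Type*} {R : V → V → Prop} (hR : ∀ u v, R u v → R v u)
    {L Y : Finset V} {c : ℕ} (hc : ∀ y ∈ Y, #{v ∈ L | R y v} ≤ c) :
    pairCount R L ≤ pairCount R (L \ Y) + 2 * (c * #Y) := by
  have hsub : {p ∈ L ×ˢ L | R p.1 p.2} ⊆ {p ∈ (L \ Y) ×ˢ (L \ Y) | R p.1 p.2} ∪
      ((Y.biUnion fun y => {v ∈ L | R y v}.image fun v => (y, v)) ∪
        Y.biUnion fun y => {v ∈ L | R y v}.image fun v => (v, y)) := by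
    rintro ⟨u, v⟩ h
    simp only [mem_filter, mem_product] at h
    obtain ⟨⟨hu, hv⟩, huv⟩ := h
    by_cases huY : u ∈ Y
    · refine mem_union_right _ (mem_union_left _ ?_)
      exact mem_biUnion.2 ⟨u, huY, mem_image.2 ⟨v, by simp [hv, huv], rfl⟩⟩
    by_cases hvY : v ∈ Y
    · refine mem_union_right _ (mem_union_right _ ?_)
      exact mem_biUnion.2 ⟨v, hvY, mem_image.2 ⟨u, by simp [hu, hR _ _ huv], rfl⟩⟩
    · exact mem_union_left _ (by simp [hu, hv, huY, hvY, huv])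
  have h1 : #(Y.biUnion fun y => {v ∈ L | R y v}.image fun v => (y, v)) ≤ #Y * c :=
    card_biUnion_le_card_mul _ _ _ fun y hy => card_image_le.trans (hc y hy)
  have h2 : #(Y.biUnion fun y => {v ∈ L | R y v}.image fun v => (v, y)) ≤ #Y * c :=
    card_biUnion_le_card_mul _ _ _ fun y hy => card_image_le.trans (hc y hy)
  have h3 := (card_le_card hsub).trans (card_union_le _ _)
  have h4 := card_union_le (Y.biUnion fun y => {v ∈ L | R y v}.image fun v => (y, v))
    (Y.biUnion fun y => {v ∈ L | R y v}.image fun v => (v, y))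
  unfold pairCount
  rw [mul_comm #Y c] at h1 h2
  omega

theorem mul_card_high_degree_le {V : Type*} {R : V → V → Prop} {L : Finset V} {e : ℕ} :
    e * #{u ∈ L | e ≤ #{v ∈ L | R u v}} ≤ pairCount R L := by
  have h : pairCount R L = ∑ u ∈ L, #{v ∈ L | R u v} := by
    rw [pairCount, card_filter, sum_product]
    exact sum_congr rfl fun u _ => (card_filter _ _).symm
  rw [h, mul_comm]
  calc #{u ∈ L | e ≤ #{v ∈ L | R u v}} * e
      ≤ ∑ u ∈ L with e ≤ #{v ∈ L | R u v}, #{v ∈ L | R u v} := by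
        rw [← smul_eq_mul]
        exact card_nsmul_le_sum _ _ _ fun u hu => (mem_filter.1 hu).2
    _ ≤ _ := sum_le_sum_of_subset (filter_subset _ _)

/-! ### Long paths -/

/-- The set `S` is the vertex set of a path of `H`. -/
def IsPathSet {V : Type*} (H : SimpleGraph V) (S : Finset V) : Prop :=
  ∃ (a b : V) (p : H.Walk a b), p.IsPath ∧ p.support.toFinset = S

/-- A path may be prolonged greedily as long as it is no longer than the minimum degree. -/
theorem exists_isPathSet_of_le_degree {V : Type*} {H : SimpleGraph V} {L : Finset V}
    (hL : L.Nonempty) {g : ℕ} (hdeg : ∀ u ∈ L, g ≤ #{v ∈ L | H.Adj u v}) :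
    ∃ S ⊆ L, IsPathSet H S ∧ g ≤ #S := by
  have key : ∀ m ≤ g, ∃ (a b : V) (p : H.Walk a b), p.IsPath ∧ p.support.toFinset ⊆ L ∧
      #p.support.toFinset = m + 1 := by
    intro m
    induction m with
    | zero =>
      intro _
      obtain ⟨a, ha⟩ := hL
      exact ⟨a, a, .nil, by simp, by simpa using ha, by simp⟩
    | succ m ih =>
      intro hm
      obtain ⟨a, b, p, hp, hpL, hcard⟩ := ih (by omega)
      have haS : a ∈ p.support.toFinset := by simp
      have h1 : #(p.support.toFinset.erase a) < #{v ∈ L | H.Adj a v} := by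
        rw [card_erase_of_mem haS, hcard]
        exact lt_of_lt_of_le (by omega) (hdeg a (hpL haS))
      obtain ⟨v, hv, hvS⟩ := exists_mem_notMem_of_card_lt_card h1
      simp only [mem_filter] at hv
      have hvp : v ∉ p.support := fun h => hvS (mem_erase.2 ⟨hv.2.ne', by simpa using h⟩)
      refine ⟨v, b, .cons hv.2.symm p, (SimpleGraph.Walk.cons_isPath_iff _ _).2 ⟨hp, hvp⟩, ?_, ?_⟩
      · rw [SimpleGraph.Walk.support_cons, List.toFinset_cons]
        exact insert_subset hv.1 hpL
      · rw [SimpleGraph.Walk.support_cons, List.toFinset_cons,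
          card_insert_of_notMem (by simpa using hvp), hcard]
  obtain ⟨a, b, p, hp, hpL, hcard⟩ := key g le_rfl
  exact ⟨_, hpL, ⟨a, b, p, hp, rfl⟩, by omega⟩

theorem pairCount_adj_le_of_no_long_path {V : Type*} {H : SimpleGraph V} {g : ℕ} (L : Finset V)
    (hL : ∀ S ⊆ L, IsPathSet H S → #S < g) : pairCount H.Adj L ≤ 2 * (g * #L) := by
  induction L using Finset.strongInduction with
  | H L ih =>
    rcases L.eq_empty_or_nonempty with rfl | hne
    · simp [pairCount]
    obtain ⟨u, hu, hdeg⟩ : ∃ u ∈ L, #{v ∈ L | H.Adj u v} < g := by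
      by_contra! hcon
      obtain ⟨S, hSL, hS, hgS⟩ := exists_isPathSet_of_le_degree hne hcon
      exact absurd (hL S hSL hS) (by omega)
    have h1 := pairCount_le_sdiff_add (R := H.Adj) (fun _ _ h => h.symm) (L := L) (Y := {u})
      (c := g) (by simpa using hdeg.le)
    have h2 := ih (L \ {u}) (sdiff_ssubset (by simpa using hu) (by simp))
      fun S hS => hL S (hS.trans sdiff_subset)
    have h3 : #(L \ {u}) + 1 = #L := by rw [sdiff_singleton_eq_erase, card_erase_add_one hu]
    rw [← h3]
    simp only [card_singleton] at h1
    linarith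

/-! ### Joining paths into cycles -/

/-- Any two vertices of `K` are joined by a walk of `H` inside `K`. -/
def IsWalkConnected {V : Type*} (H : SimpleGraph V) (K : Finset V) : Prop :=
  ∀ x ∈ K, ∀ y ∈ K, ∃ p : H.Walk x y, ∀ v ∈ p.support, v ∈ K

theorem IsWalkConnected.insert_of_adj {V : Type*} {H : SimpleGraph V} {K : Finset V}
    (hK : IsWalkConnected H K) {x y : V} (hx : x ∈ K) (hxy : H.Adj x y) :
    IsWalkConnected H (insert y K) := by
  have key : ∀ z ∈ K, ∃ p : H.Walk y z, ∀ v ∈ p.support, v ∈ insert y K := by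
    intro z hz
    obtain ⟨p, hp⟩ := hK x hx z hz
    refine ⟨.cons hxy.symm p, fun v hv => ?_⟩
    rw [SimpleGraph.Walk.support_cons, List.mem_cons] at hv
    exact hv.elim (fun h => h ▸ mem_insert_self _ _) fun h => mem_insert_of_mem (hp v h)
  intro a ha b hb
  rcases mem_insert.1 ha with rfl | ha' <;> rcases mem_insert.1 hb with rfl | hb'
  · exact ⟨.nil, by simp⟩
  · exact key b hb'
  · obtain ⟨p, hp⟩ := key a ha'
    exact ⟨p.reverse, by simpa using hp⟩
  · obtain ⟨p, hp⟩ := hK a ha' b hb'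
    exact ⟨p, fun v hv => mem_insert_of_mem (hp v hv)⟩

/-- A connected set `K` prolongs a path whose last vertex has a neighbour in `K` to any given
vertex of `K`. -/
theorem exists_path_append {V : Type*} {H : SimpleGraph V} {a b x y : V} {p : H.Walk a b}
    (hp : p.IsPath) {K : Finset V} (hK : IsWalkConnected H K) (hx : x ∈ K) (hy : y ∈ K)
    (hbx : H.Adj b x) (hdisj : ∀ v ∈ p.support, v ∉ K) :
    ∃ q : H.Walk a y, q.IsPath ∧ p.length < q.length ∧ (∀ v ∈ p.support, v ∈ q.support) ∧
      ∀ v ∈ q.support, v ∈ p.support ∨ v ∈ K := by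
  obtain ⟨q, hq⟩ := hK x hx y hy
  have hqK : ∀ v ∈ q.bypass.support, v ∈ K := fun v hv => hq v (q.support_bypass_subset_support hv)
  refine ⟨p.append (.cons hbx q.bypass), ?_, ?_, ?_, ?_⟩
  · rw [SimpleGraph.Walk.isPath_def, SimpleGraph.Walk.support_append,
      SimpleGraph.Walk.support_cons, List.tail_cons, List.nodup_append']
    exact ⟨hp.support_nodup, q.bypass_isPath.support_nodup,
      fun v hv hv' => hdisj v hv (hqK v hv')⟩
  · simp
  · intro v hv
    exact (SimpleGraph.Walk.mem_support_append_iff _ _).2 (Or.inl hv)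
  · intro v hv
    rw [SimpleGraph.Walk.support_append, SimpleGraph.Walk.support_cons, List.tail_cons,
      List.mem_append] at hv
    exact hv.imp id (hqK v)

/-- The set `S` is the vertex set of a path of `H` whose ends lie in `T`. -/
def IsPathBetween {V : Type*} (H : SimpleGraph V) (T S : Finset V) : Prop :=
  ∃ (a b : V) (p : H.Walk a b), p.IsPath ∧ p.support.toFinset = S ∧ a ∈ T ∧ b ∈ T

theorem IsPathSet.isPathBetween {V : Type*} {H : SimpleGraph V} {S T : Finset V}
    (hS : IsPathSet H S) (hST : S ⊆ T) : IsPathBetween H T S := by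
  obtain ⟨a, b, p, hp, rfl⟩ := hS
  exact ⟨a, b, p, hp, rfl, hST (by simp), hST (by simp)⟩

/-- Two disjoint paths are joined into one through a connected set in which their ends have
neighbours. -/
theorem IsPathBetween.exists_join {V : Type*} {H : SimpleGraph V} {S₁ S₂ K T : Finset V}
    (h₁ : IsPathBetween H T S₁) (h₂ : IsPathBetween H T S₂) (hS : Disjoint S₁ S₂)
    (hK : IsWalkConnected H K) (hK₁ : Disjoint S₁ K) (hK₂ : Disjoint S₂ K)
    (hN : ∀ v ∈ T, ∃ x ∈ K, H.Adj v x) :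
    ∃ S, IsPathBetween H T S ∧ S₁ ∪ S₂ ⊆ S ∧ S ⊆ S₁ ∪ S₂ ∪ K := by
  obtain ⟨a, b, p, hp, rfl, ha, hb⟩ := h₁
  obtain ⟨c, d, p', hp', rfl, hc, hd⟩ := h₂
  obtain ⟨x, hx, hbx⟩ := hN b hb
  obtain ⟨y, hy, hcy⟩ := hN c hc
  obtain ⟨q, hq, -, hpq, hqK⟩ := exists_path_append hp hK hx hy hbx fun v hv hvK =>
    disjoint_left.1 hK₁ (by simpa using hv) hvK
  refine ⟨(q.append (.cons hcy.symm p')).support.toFinset, ⟨a, d, _, ?_, rfl, ha, hd⟩, ?_, ?_⟩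
  · rw [SimpleGraph.Walk.isPath_def, SimpleGraph.Walk.support_append,
      SimpleGraph.Walk.support_cons, List.tail_cons, List.nodup_append']
    refine ⟨hq.support_nodup, hp'.support_nodup, fun v hv hv' => ?_⟩
    rcases hqK v hv with h | h
    · exact disjoint_left.1 hS (by simpa using h) (by simpa using hv')
    · exact disjoint_left.1 hK₂ (by simpa using hv') h
  · intro v hv
    simp only [mem_union, List.mem_toFinset] at hv
    rw [List.mem_toFinset, SimpleGraph.Walk.support_append, SimpleGraph.Walk.support_cons,
      List.tail_cons, List.mem_append]
    exact hv.imp (hpq v) id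
  · intro v hv
    rw [List.mem_toFinset, SimpleGraph.Walk.support_append, SimpleGraph.Walk.support_cons,
      List.tail_cons, List.mem_append] at hv
    simp only [mem_union, List.mem_toFinset]
    rcases hv with hv | hv
    · rcases hqK v hv with h | h <;> simp [h]
    · simp [hv]

/-- A path is closed to a cycle through a connected set in which its ends have neighbours. -/
theorem IsPathBetween.exists_cycle {V : Type*} {H : SimpleGraph V} {S K T : Finset V}
    (hS : IsPathBetween H T S) (hcard : 2 ≤ #S) (hK : IsWalkConnected H K) (hSK : Disjoint S K)
    (hN : ∀ v ∈ T, ∃ x ∈ K, H.Adj v x) :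
    ∃ (v : V) (p : H.Walk v v), p.IsCycle ∧ S ⊆ p.support.toFinset ∧
      p.support.toFinset ⊆ S ∪ K := by
  obtain ⟨a, b, p, hp, rfl, ha, hb⟩ := hS
  obtain ⟨x, hx, hbx⟩ := hN b hb
  obtain ⟨y, hy, hay⟩ := hN a ha
  obtain ⟨q, hq, hlen, hpq, hqK⟩ := exists_path_append hp hK hx hy hbx fun v hv hvK =>
    disjoint_left.1 hSK (by simpa using hv) hvK
  have hlp : 1 ≤ p.length := by
    have := p.support.toFinset_card_le
    rw [SimpleGraph.Walk.length_support] at this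
    omega
  refine ⟨y, .cons hay.symm q, (SimpleGraph.Walk.cons_isCycle_iff _ _).2 ⟨hq, fun h => ?_⟩, ?_, ?_⟩
  · rw [Sym2.eq_swap] at h
    have := hq.length_eq_one_of_mem_edges h
    omega
  · intro v hv
    simp only [List.mem_toFinset, SimpleGraph.Walk.support_cons, List.mem_cons] at hv ⊢
    exact Or.inr (hpq v hv)
  · intro v hv
    simp only [List.mem_toFinset, SimpleGraph.Walk.support_cons, List.mem_cons, mem_union] at hv ⊢
    rcases hv with rfl | hv
    · exact Or.inr hy
    · exact hqK v hv

/-- Disjoint paths are strung together to one path. The ends of the new path again lie in `T`, which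
is what allows a further path to be attached. -/
theorem exists_path_through_paths {V : Type*} {H : SimpleGraph V} {T : Finset V}
    {K : ℕ → Finset V} {M : ℕ} (hK : ∀ j < M, IsWalkConnected H (K j))
    (hKK : ∀ i < M, ∀ j < M, i ≠ j → Disjoint (K i) (K j)) (hKT : ∀ j < M, Disjoint T (K j))
    (hN : ∀ j < M, ∀ v ∈ T, ∃ x ∈ K j, H.Adj v x) (P : Finset (Finset V)) (hP : P.Nonempty)
    (hcard : #P ≤ M) (hPT : ∀ S ∈ P, S ⊆ T) (hpath : ∀ S ∈ P, IsPathSet H S)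
    (hdisj : ∀ S ∈ P, ∀ S' ∈ P, S ≠ S' → Disjoint S S') :
    ∃ S, IsPathBetween H T S ∧ P.biUnion id ⊆ S ∧
      S ⊆ P.biUnion id ∪ (range (#P - 1)).biUnion K := by
  induction hP using Finset.Nonempty.cons_induction with
  | singleton S =>
    refine ⟨S, (hpath S (by simp)).isPathBetween (hPT S (by simp)), by simp, by simp⟩
  | cons S P hSP hP ih =>
    rw [card_cons] at hcard
    have hpos := hP.card_pos
    obtain ⟨Q, hQ, hPQ, hQK⟩ := ih (by omega) (fun S' h => hPT S' (mem_cons_of_mem h))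
      (fun S' h => hpath S' (mem_cons_of_mem h))
      fun S₁ h₁ S₂ h₂ => hdisj S₁ (mem_cons_of_mem h₁) S₂ (mem_cons_of_mem h₂)
    have hST := hPT S (mem_cons_self _ _)
    have hPT' : P.biUnion id ⊆ T := biUnion_subset.2 fun S' h => hPT S' (mem_cons_of_mem h)
    have hj : #P - 1 < M := by omega
    obtain ⟨R, hR, hSQR, hRK⟩ := ((hpath S (mem_cons_self _ _)).isPathBetween hST).exists_join hQ
      (by
        refine Disjoint.mono_right hQK (disjoint_union_right.2 ⟨?_, ?_⟩)
        · refine (disjoint_biUnion_right _ _ _).2 fun S' h =>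
            hdisj S (mem_cons_self _ _) S' (mem_cons_of_mem h) ?_
          rintro rfl
          exact hSP h
        · refine (disjoint_biUnion_right _ _ _).2 fun j h => ?_
          exact (hKT j (by have := mem_range.1 h; omega)).mono_left hST)
      (hK _ hj) ((hKT _ hj).mono_left hST)
      (by
        refine Disjoint.mono_left hQK (disjoint_union_left.2 ⟨(hKT _ hj).mono_left hPT', ?_⟩)
        refine (disjoint_biUnion_left _ _ _).2 fun j h => ?_
        have := mem_range.1 h
        exact hKK j (by omega) _ hj (by omega)) (hN _ hj)
    refine ⟨R, hR, ?_, hRK.trans ?_⟩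
    · rw [cons_eq_insert, biUnion_insert]
      exact (union_subset_union_right hPQ).trans hSQR
    · rw [cons_eq_insert, biUnion_insert, card_insert_of_notMem hSP]
      intro v hv
      have hPv : v ∈ Q → v ∈ P.biUnion id ∨ v ∈ (range (#P - 1)).biUnion K :=
        fun h => mem_union.1 (hQK h)
      have hmono : (range (#P - 1)).biUnion K ⊆ (range (#P + 1 - 1)).biUnion K :=
        biUnion_subset_biUnion_of_subset_left _ (range_subset_range.2 (by omega))
      have hlast : K (#P - 1) ⊆ (range (#P + 1 - 1)).biUnion K :=
        subset_biUnion_of_mem K (mem_range.2 (by omega))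
      simp only [mem_union, id] at hv ⊢
      rcases hv with (hv | hv) | hv
      · exact Or.inl (Or.inl hv)
      · exact (hPv hv).elim (fun h => Or.inl (Or.inr h)) fun h => Or.inr (hmono h)
      · exact Or.inr (hlast hv)

/-- Disjoint paths are strung together to a cycle by means of as many disjoint connected sets, in
each of which every vertex of the paths has a neighbour. -/
theorem exists_cycle_through_paths {V : Type*} {H : SimpleGraph V} {T : Finset V}
    {K : ℕ → Finset V} {M : ℕ} (hK : ∀ j < M, IsWalkConnected H (K j))
    (hKK : ∀ i < M, ∀ j < M, i ≠ j → Disjoint (K i) (K j)) (hKT : ∀ j < M, Disjoint T (K j))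
    (hN : ∀ j < M, ∀ v ∈ T, ∃ x ∈ K j, H.Adj v x) (P : Finset (Finset V)) (hP : P.Nonempty)
    (hcard : #P ≤ M) (hPT : ∀ S ∈ P, S ⊆ T) (hpath : ∀ S ∈ P, IsPathSet H S)
    (hdisj : ∀ S ∈ P, ∀ S' ∈ P, S ≠ S' → Disjoint S S') (htwo : ∀ S ∈ P, 2 ≤ #S) :
    ∃ (v : V) (p : H.Walk v v), p.IsCycle ∧ P.biUnion id ⊆ p.support.toFinset ∧
      p.support.toFinset ⊆ P.biUnion id ∪ (range M).biUnion K := by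
  obtain ⟨Q, hQ, hPQ, hQK⟩ := exists_path_through_paths hK hKK hKT hN P hP hcard hPT hpath hdisj
  have hpos := hP.card_pos
  have hj : #P - 1 < M := by omega
  have hPT' : P.biUnion id ⊆ T := biUnion_subset.2 hPT
  obtain ⟨S, hS⟩ := hP
  obtain ⟨v, p, hp, hQp, hpK⟩ := hQ.exists_cycle
    ((htwo S hS).trans (card_le_card ((subset_biUnion_of_mem id hS).trans hPQ))) (hK _ hj)
    (by
      refine Disjoint.mono_left hQK (disjoint_union_left.2 ⟨(hKT _ hj).mono_left hPT', ?_⟩)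
      refine (disjoint_biUnion_left _ _ _).2 fun j h => ?_
      have := mem_range.1 h
      exact hKK j (by omega) _ hj (by omega)) (hN _ hj)
  refine ⟨v, p, hp, hPQ.trans hQp, hpK.trans (union_subset (hQK.trans ?_) ?_)⟩
  · exact union_subset_union_right
      (biUnion_subset_biUnion_of_subset_left _ (range_subset_range.2 hj.le))
  · exact (subset_biUnion_of_mem K (mem_range.2 hj)).trans subset_union_right

/-! ### Decomposition into highly connected sets -/

/-- The vertices of `X` outside `A` that have a neighbour in `A`. -/
noncomputable def boundary {V : Type*} (H : SimpleGraph V) (X A : Finset V) : Finset V :=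
  {v ∈ X \ A | ∃ a ∈ A, H.Adj a v}

/-- No nonempty `A ⊆ X` is separated from a vertex of `X` by fewer than `k` vertices of `X`. -/
def IsHighlyConnected {V : Type*} (H : SimpleGraph V) (k : ℕ) (X : Finset V) : Prop :=
  ∀ A ⊆ X, A.Nonempty → #(boundary H X A) < k → X ⊆ A ∪ boundary H X A

/-- Adjacent vertices of `H` that do not lie in a common member of `P`. -/
def AdjAcross {V : Type*} (H : SimpleGraph V) (P : Finset (Finset V)) (u v : V) : Prop :=
  H.Adj u v ∧ ¬ ∃ X ∈ P, u ∈ X ∧ v ∈ X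

theorem AdjAcross.symm {V : Type*} {H : SimpleGraph V} {P : Finset (Finset V)} {u v : V}
    (h : AdjAcross H P u v) : AdjAcross H P v u :=
  ⟨h.1.symm, fun ⟨X, hX, hv, hu⟩ => h.2 ⟨X, hX, hu, hv⟩⟩

/-- Up to a small set `T` and few edges, a graph splits into highly connected sets. As long as a
set is separated by fewer than `k` vertices, it is cut there: a side with fewer than `d` vertices
is dropped at the cost of its edges, and between two large sides the separator goes to `T`. -/
theorem exists_decomposition {V : Type*} (H : SimpleGraph V) (d k : ℕ) (S : Finset V) :
    ∃ T ⊆ S, ∃ P : Finset (Finset V),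
      (∀ X ∈ P, X ⊆ S \ T ∧ d ≤ #X ∧ IsHighlyConnected H k X) ∧
      (∀ X ∈ P, ∀ Y ∈ P, X ≠ Y → Disjoint X Y) ∧ d * #T ≤ k * (#S - d) ∧
      pairCount (AdjAcross H P) (S \ T) ≤ 2 * ((d + k) * #S) := by
  induction S using Finset.strongInduction with
  | H S ih =>
    by_cases hsmall : ∃ Y ⊆ S, Y.Nonempty ∧ #Y < d ∧ #(boundary H S Y) ≤ k
    · obtain ⟨Y, hYS, hY, hYd, hYk⟩ := hsmall
      obtain ⟨T, hT, P, hP, hPd, hTc, hpairs⟩ := ih (S \ Y) (sdiff_ssubset hYS hY)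
      have hcard := card_sdiff_add_card_eq_card hYS
      refine ⟨T, hT.trans sdiff_subset, P, fun X hX => ⟨?_, (hP X hX).2⟩, hPd, ?_, ?_⟩
      · exact (hP X hX).1.trans (sdiff_subset_sdiff sdiff_subset le_rfl)
      · exact hTc.trans (Nat.mul_le_mul_left _ (by omega))
      have h1 := pairCount_le_sdiff_add (R := AdjAcross H P) (fun _ _ h => h.symm) (L := S \ T)
        (Y := Y) (c := d + k) fun y hy => by
          have hsub : {v ∈ S \ T | AdjAcross H P y v} ⊆ Y ∪ boundary H S Y := by
            intro v hv
            simp only [mem_filter, mem_sdiff] at hv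
            by_cases hvY : v ∈ Y
            · exact mem_union_left _ hvY
            · exact mem_union_right _ (mem_filter.2
                ⟨mem_sdiff.2 ⟨hv.1.1, hvY⟩, y, hy, hv.2.1⟩)
          have := card_le_card hsub
          have := card_union_le Y (boundary H S Y)
          omega
      rw [sdiff_right_comm] at hpairs
      rw [← hcard]
      linarith
    rcases lt_or_ge #S d with hSd | hSd
    · -- a nonempty set of fewer than `d` vertices would itself be a small side
      have hS : S = ∅ := by
        by_contra hne
        refine hsmall ⟨S, le_rfl, nonempty_iff_ne_empty.2 hne, hSd, ?_⟩
        simp [boundary]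
      subst hS
      exact ⟨∅, le_rfl, ∅, by simp, by simp, by simp, by simp [pairCount]⟩
    by_cases hconn : IsHighlyConnected H k S
    · refine ⟨∅, empty_subset _, {S}, by simpa using ⟨hSd, hconn⟩, by simp, by simp, ?_⟩
      have : pairCount (AdjAcross H {S}) (S \ ∅) = 0 := by
        rw [pairCount, card_eq_zero, filter_eq_empty_iff]
        rintro ⟨u, v⟩ huv ⟨-, h⟩
        simp only [sdiff_empty, mem_product] at huv
        exact h ⟨S, by simp, huv.1, huv.2⟩
      omega
    unfold IsHighlyConnected at hconn
    push Not at hconn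
    obtain ⟨A, hAS, hA, hAk, hcov⟩ := hconn
    set C := boundary H S A with hC
    have hCS : C ⊆ S \ A := filter_subset _ _
    set B := (S \ A) \ C with hB
    have hBS : B ⊆ S := sdiff_subset.trans sdiff_subset
    have hAB : Disjoint A B := disjoint_left.2 fun v hv hvB =>
      (mem_sdiff.1 (mem_sdiff.1 hvB).1).2 hv
    have hadj : ∀ a ∈ A, ∀ v ∈ B, ¬ H.Adj a v := fun a ha v hv h =>
      (mem_sdiff.1 hv).2 (mem_filter.2 ⟨(mem_sdiff.1 hv).1, a, ha, h⟩)
    have hBne : B.Nonempty := by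
      obtain ⟨v, hv, hvAC⟩ := not_subset.1 hcov
      rw [mem_union, not_or] at hvAC
      exact ⟨v, mem_sdiff.2 ⟨mem_sdiff.2 ⟨hv, hvAC.1⟩, hvAC.2⟩⟩
    have hcard : #A + #B + #C = #S := by
      have h1 := card_sdiff_add_card_eq_card hAS
      have h2 := card_sdiff_add_card_eq_card hCS
      rw [hB]
      omega
    have hAd : d ≤ #A := by
      by_contra! h
      exact hsmall ⟨A, hAS, hA, h, hAk.le⟩
    have hBd : d ≤ #B := by
      by_contra! h
      refine hsmall ⟨B, hBS, hBne, h, (card_le_card fun v hv => ?_).trans hAk.le⟩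
      obtain ⟨hv, b, hb, hbv⟩ := mem_filter.1 hv
      by_contra hvC
      refine (mem_sdiff.1 hv).2 (mem_sdiff.2 ⟨mem_sdiff.2 ⟨(mem_sdiff.1 hv).1, fun hvA => ?_⟩, hvC⟩)
      exact hadj v hvA b hb hbv.symm
    obtain ⟨TA, hTA, PA, hPA, hPAd, hTAc, hpA⟩ := ih A (ssubset_of_subset_not_subset hAS
      fun h => by
        obtain ⟨v, hv⟩ := hBne
        exact disjoint_left.1 hAB (h (hBS hv)) hv)
    obtain ⟨TB, hTB, PB, hPB, hPBd, hTBc, hpB⟩ := ih B (ssubset_of_subset_not_subset hBS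
      fun h => by
        obtain ⟨v, hv⟩ := hA
        exact disjoint_left.1 hAB hv (h (hAS hv)))
    have hST : S \ (C ∪ TA ∪ TB) ⊆ (A \ TA) ∪ (B \ TB) := by
      intro v hv
      simp only [mem_sdiff, mem_union, not_or] at hv ⊢
      by_cases hvA : v ∈ A
      · exact Or.inl ⟨hvA, hv.2.1.2⟩
      · exact Or.inr ⟨mem_sdiff.2 ⟨mem_sdiff.2 ⟨hv.1, hvA⟩, hv.2.1.1⟩, hv.2.2⟩
    have hAsub : A \ TA ⊆ S \ (C ∪ TA ∪ TB) := by
      intro v hv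
      simp only [mem_sdiff, mem_union, not_or] at hv ⊢
      exact ⟨hAS hv.1, ⟨fun h => (mem_sdiff.1 (hCS h)).2 hv.1, hv.2⟩,
        fun h => disjoint_left.1 hAB hv.1 (hTB h)⟩
    have hBsub : B \ TB ⊆ S \ (C ∪ TA ∪ TB) := by
      intro v hv
      simp only [mem_sdiff, mem_union, not_or] at hv ⊢
      exact ⟨hBS hv.1, ⟨(mem_sdiff.1 hv.1).2, fun h => disjoint_left.1 hAB (hTA h) hv.1⟩, hv.2⟩
    have hPAB : ∀ X ∈ PA, ∀ Y ∈ PB, Disjoint X Y := fun X hX Y hY =>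
      hAB.mono ((hPA X hX).1.trans sdiff_subset) ((hPB Y hY).1.trans sdiff_subset)
    refine ⟨C ∪ TA ∪ TB, union_subset (union_subset (hCS.trans sdiff_subset) (hTA.trans hAS))
      (hTB.trans hBS), PA ∪ PB, ?_, ?_, ?_, ?_⟩
    · intro X hX
      rcases mem_union.1 hX with hX | hX
      · exact ⟨(hPA X hX).1.trans hAsub, (hPA X hX).2⟩
      · exact ⟨(hPB X hX).1.trans hBsub, (hPB X hX).2⟩
    · intro X hX Y hY hXY
      rcases mem_union.1 hX with hX | hX <;> rcases mem_union.1 hY with hY | hY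
      · exact hPAd X hX Y hY hXY
      · exact hPAB X hX Y hY
      · exact (hPAB Y hY X hX).symm
      · exact hPBd X hX Y hY hXY
    · have h1 : #(C ∪ TA ∪ TB) ≤ #C + #TA + #TB :=
        (card_union_le _ _).trans (Nat.add_le_add_right (card_union_le _ _) _)
      calc d * #(C ∪ TA ∪ TB) ≤ d * (#C + #TA + #TB) := Nat.mul_le_mul_left _ h1
        _ = #C * d + d * #TA + d * #TB := by ring
        _ ≤ k * d + k * (#A - d) + k * (#B - d) :=
          Nat.add_le_add (Nat.add_le_add (Nat.mul_le_mul_right _ hAk.le) hTAc) hTBc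
        _ = k * (d + (#A - d) + (#B - d)) := by ring
        _ ≤ k * (#S - d) := Nat.mul_le_mul_left _ (by omega)
    · have hsub : {p ∈ (S \ (C ∪ TA ∪ TB)) ×ˢ (S \ (C ∪ TA ∪ TB)) |
          AdjAcross H (PA ∪ PB) p.1 p.2} ⊆
          {p ∈ (A \ TA) ×ˢ (A \ TA) | AdjAcross H PA p.1 p.2} ∪
          {p ∈ (B \ TB) ×ˢ (B \ TB) | AdjAcross H PB p.1 p.2} := by
        rintro ⟨u, v⟩ h
        simp only [mem_filter, mem_product] at h
        obtain ⟨⟨hu, hv⟩, hadj', hne⟩ := h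
        have hneA : ¬ ∃ X ∈ PA, u ∈ X ∧ v ∈ X := fun ⟨X, hX, h⟩ => hne ⟨X, mem_union_left _ hX, h⟩
        have hneB : ¬ ∃ X ∈ PB, u ∈ X ∧ v ∈ X := fun ⟨X, hX, h⟩ => hne ⟨X, mem_union_right _ hX, h⟩
        rcases mem_union.1 (hST hu) with hu | hu <;> rcases mem_union.1 (hST hv) with hv | hv
        · exact mem_union_left _ (mem_filter.2 ⟨mem_product.2 ⟨hu, hv⟩, hadj', hneA⟩)
        · exact absurd hadj' (hadj u (mem_sdiff.1 hu).1 v (mem_sdiff.1 hv).1)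
        · exact absurd hadj'.symm (hadj v (mem_sdiff.1 hv).1 u (mem_sdiff.1 hu).1)
        · exact mem_union_right _ (mem_filter.2 ⟨mem_product.2 ⟨hu, hv⟩, hadj', hneB⟩)
      have h1 := (card_le_card hsub).trans (card_union_le _ _)
      have h2 : (d + k) * #A + (d + k) * #B ≤ (d + k) * #S := by
        rw [← Nat.mul_add]
        exact Nat.mul_le_mul_left _ (by omega)
      unfold pairCount at *
      omega

/-! ### Small connected sets that see almost everything -/

/-- The vertices of `X` that lie in `K` or have a neighbour in `K`. -/
noncomputable def seen {V : Type*} (H : SimpleGraph V) (X K : Finset V) : Finset V :=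
  {u ∈ X | u ∈ K ∨ ∃ x ∈ K, H.Adj u x}

theorem card_seen_add_le {V : Type*} {H : SimpleGraph V} {X K K' N : Finset V} (hK : K ⊆ K')
    (hNX : N ⊆ X \ seen H X K) (hN : ∀ v ∈ N, ∃ x ∈ K', H.Adj v x) :
    #(seen H X K) + #N ≤ #(seen H X K') := by
  rw [← card_union_of_disjoint (disjoint_left.2 fun v hv hvN => (mem_sdiff.1 (hNX hvN)).2 hv)]
  refine card_le_card (union_subset (fun v hv => ?_) fun v hv => ?_)
  · obtain ⟨hvX, h⟩ := mem_filter.1 hv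
    exact mem_filter.2 ⟨hvX, h.imp (fun h => hK h) fun ⟨x, hx, h⟩ => ⟨x, hK hx, h⟩⟩
  · exact mem_filter.2 ⟨(mem_sdiff.1 (hNX hv)).1, Or.inr (hN v hv)⟩

theorem IsHighlyConnected.le_degree {V : Type*} {H : SimpleGraph V} {k : ℕ} {X : Finset V}
    (hX : IsHighlyConnected H k X) (hk : k < #X) {u : V} (hu : u ∈ X) :
    k ≤ #{v ∈ X | H.Adj u v} := by
  have hsub : boundary H X {u} ⊆ {v ∈ X | H.Adj u v} := by
    intro v hv
    simp only [boundary, mem_filter, mem_sdiff, mem_singleton, exists_eq_left] at hv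
    exact mem_filter.2 ⟨hv.1.1, hv.2⟩
  by_contra! hlt
  have hlt' := (card_le_card hsub).trans_lt hlt
  have h1 := card_le_card (hX {u} (by simpa using hu) (by simp) hlt')
  have h2 := card_union_le {u} (boundary H X {u})
  rw [card_singleton] at h2
  omega

/-- If a connected set `K` leaves `k` vertices of `X` unseen, it has an extension by one or two
vertices that sees a positive proportion more. High connectivity makes many unseen vertices
adjacent to vertices seen outside `F`; one of the former sees many unseen vertices, or one of the
latter does. -/
theorem exists_growth {V : Type*} {H : SimpleGraph V} {k : ℕ} {X F K : Finset V}
    (hX : IsHighlyConnected H k X) (hk : k < #X) (hk0 : 0 < k) (hF : 4 * #F ≤ k) (hKX : K ⊆ X \ F)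
    (hKne : K.Nonempty) (hK : IsWalkConnected H K) (hU : k ≤ #(X \ seen H X K)) :
    ∃ K' ⊆ X \ F, IsWalkConnected H K' ∧ #K < #K' ∧
      k ^ 2 * #K' + 8 * #X * #(seen H X K) ≤ k ^ 2 * #K + 8 * #X * #(seen H X K') := by
  set U := X \ seen H X K with hUdef
  set B := {x ∈ X | x ∉ K ∧ x ∉ F ∧ ∃ y ∈ K, H.Adj x y} with hB
  set U' := {u ∈ U \ F | ∃ x ∈ B, H.Adj u x} with hU'
  have hUX : ∀ u ∈ U, u ∈ X := fun u hu => (mem_sdiff.1 hu).1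
  have hUK : ∀ u ∈ U, u ∉ K := fun u hu h =>
    (mem_sdiff.1 hu).2 (mem_filter.2 ⟨hUX u hu, Or.inl h⟩)
  have hUadj : ∀ u ∈ U, ∀ x ∈ K, ¬ H.Adj u x := fun u hu x hx h =>
    (mem_sdiff.1 hu).2 (mem_filter.2 ⟨hUX u hu, Or.inr ⟨x, hx, h⟩⟩)
  have hU'U : ∀ u ∈ U', u ∈ U := fun u hu => (mem_sdiff.1 (mem_filter.1 hu).1).1
  have hcases : ∀ v ∈ X, v ∉ F → v ∈ K ∨ v ∈ B ∨ v ∈ U := by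
    intro v hvX hvF
    by_cases hvK : v ∈ K
    · exact Or.inl hvK
    by_cases hv : ∃ y ∈ K, H.Adj v y
    · exact Or.inr (Or.inl (mem_filter.2 ⟨hvX, hvK, hvF, hv⟩))
    · refine Or.inr (Or.inr (mem_sdiff.2 ⟨hvX, fun h => ?_⟩))
      exact (mem_filter.1 h).2.elim hvK hv
  -- otherwise `U' ∪ F` would separate the unseen vertices outside it from `K`
  have hU'card : k ≤ #U' + #F := by
    by_contra! hlt
    have hAne : (U \ (U' ∪ F)).Nonempty := by
      have h1 := le_card_sdiff (U' ∪ F) U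
      have h2 := card_union_le U' F
      exact card_pos.1 (by omega)
    have hAX : U \ (U' ∪ F) ⊆ X := fun v hv => hUX v (mem_sdiff.1 hv).1
    have hbd : boundary H X (U \ (U' ∪ F)) ⊆ U' ∪ F := by
      intro v hv
      obtain ⟨hv, a, ha, hav⟩ := mem_filter.1 hv
      obtain ⟨haU, haUF⟩ := mem_sdiff.1 ha
      rw [mem_union, not_or] at haUF
      by_contra hvUF
      rw [mem_union, not_or] at hvUF
      rcases hcases v (mem_sdiff.1 hv).1 hvUF.2 with h | h | h
      · exact hUadj a haU v h hav
      · exact haUF.1 (mem_filter.2 ⟨mem_sdiff.2 ⟨haU, haUF.2⟩, v, h, hav⟩)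
      · exact (mem_sdiff.1 hv).2 (mem_sdiff.2 ⟨h, by simp [hvUF]⟩)
    have hcov := hX _ hAX hAne
      ((card_le_card hbd).trans_lt ((card_union_le _ _).trans_lt hlt))
    obtain ⟨y, hy⟩ := hKne
    rcases mem_union.1 (hcov (mem_sdiff.1 (hKX hy)).1) with h | h
    · exact hUK y (mem_sdiff.1 h).1 hy
    · obtain ⟨-, a, ha, hay⟩ := mem_filter.1 h
      exact hUadj a (mem_sdiff.1 ha).1 y hy hay
  have hXpos : 0 < #X := by omega
  by_cases hbig : ∃ u ∈ U', k ≤ 4 * #{v ∈ U | H.Adj u v}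
  · obtain ⟨u, hu, huk⟩ := hbig
    obtain ⟨huU, x, hx, hux⟩ := mem_filter.1 hu
    obtain ⟨hxX, hxK, hxF, y, hy, hxy⟩ := mem_filter.1 hx
    have huxK : u ∉ insert x K := by
      rw [mem_insert, not_or]
      refine ⟨?_, hUK u (hU'U u hu)⟩
      rintro rfl
      exact hUadj u (hU'U u hu) y hy hxy
    have hgain := card_seen_add_le (H := H) (X := X) (K := K) (K' := insert u (insert x K))
      (N := {v ∈ U | H.Adj u v})
      ((subset_insert _ _).trans (subset_insert _ _)) (filter_subset _ _)
      fun v hv => ⟨u, mem_insert_self _ _, (mem_filter.1 hv).2.symm⟩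
    refine ⟨insert u (insert x K), ?_,
      (hK.insert_of_adj hy hxy.symm).insert_of_adj (mem_insert_self _ _) hux.symm, ?_, ?_⟩
    · refine insert_subset (mem_sdiff.2 ⟨hUX u (hU'U u hu), (mem_sdiff.1 huU).2⟩)
        (insert_subset (mem_sdiff.2 ⟨hxX, hxF⟩) hKX)
    · rw [card_insert_of_notMem huxK, card_insert_of_notMem hxK]
      omega
    · rw [card_insert_of_notMem huxK, card_insert_of_notMem hxK]
      have h1 : 8 * #X * (#(seen H X K) + #{v ∈ U | H.Adj u v}) ≤
          8 * #X * #(seen H X (insert u (insert x K))) := Nat.mul_le_mul_left _ hgain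
      have h2 : k * k ≤ #X * (4 * #{v ∈ U | H.Adj u v}) := Nat.mul_le_mul hk.le huk
      nlinarith
  · push Not at hbig
    -- no vertex of `U'` sees many unseen vertices, so double counting between `U'` and `B` applies
    have hdegB : ∀ u ∈ U', k ≤ 2 * #{x ∈ B | H.Adj u x} := by
      intro u hu
      have h1 := hX.le_degree hk (hUX u (hU'U u hu))
      have hsub : {v ∈ X | H.Adj u v} ⊆ {v ∈ U | H.Adj u v} ∪ {x ∈ B | H.Adj u x} ∪ F := by
        intro v hv
        obtain ⟨hvX, huv⟩ := mem_filter.1 hv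
        by_cases hvF : v ∈ F
        · exact mem_union_right _ hvF
        refine mem_union_left _ ?_
        rcases hcases v hvX hvF with h | h | h
        · exact absurd huv (hUadj u (hU'U u hu) v h)
        · exact mem_union_right _ (mem_filter.2 ⟨h, huv⟩)
        · exact mem_union_left _ (mem_filter.2 ⟨h, huv⟩)
      have h2 := card_le_card hsub
      have h3 := card_union_le ({v ∈ U | H.Adj u v} ∪ {x ∈ B | H.Adj u x}) F
      have h4 := card_union_le {v ∈ U | H.Adj u v} {x ∈ B | H.Adj u x}
      have h5 := hbig u hu
      omega
    obtain ⟨x, hx, hxk⟩ : ∃ x ∈ B, k ^ 2 ≤ 8 * #X * #{u ∈ U' | H.Adj u x} := by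
      by_contra! hcon
      have h1 : ∑ u ∈ U', #{x ∈ B | H.Adj u x} = ∑ x ∈ B, #{u ∈ U' | H.Adj u x} :=
        sum_card_bipartiteAbove_eq_sum_card_bipartiteBelow _
      have h2 : #U' * k ≤ 2 * ∑ u ∈ U', #{x ∈ B | H.Adj u x} := by
        rw [mul_sum, ← smul_eq_mul]
        exact card_nsmul_le_sum _ _ _ hdegB
      have h3 : 8 * #X * ∑ x ∈ B, #{u ∈ U' | H.Adj u x} ≤ #B * k ^ 2 := by
        rw [mul_sum, ← smul_eq_mul (#B)]
        exact sum_le_card_nsmul _ _ _ fun x hx => (hcon x hx).le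
      have h4 : #B * k ^ 2 ≤ #X * k ^ 2 := Nat.mul_le_mul_right _ (card_le_card (filter_subset _ _))
      have h5 : #X * (3 * k * k) ≤ #X * (4 * #U' * k) :=
        Nat.mul_le_mul_left _ (Nat.mul_le_mul_right _ (by omega))
      have h6 : #X * (#U' * k) ≤ #X * (2 * ∑ u ∈ U', #{x ∈ B | H.Adj u x}) :=
        Nat.mul_le_mul_left _ h2
      have h7 : 0 < #X * k ^ 2 := by positivity
      rw [h1] at h6
      nlinarith
    obtain ⟨hxX, hxK, hxF, y, hy, hxy⟩ := mem_filter.1 hx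
    have hgain := card_seen_add_le (H := H) (X := X) (K := K) (K' := insert x K)
      (N := {u ∈ U' | H.Adj u x})
      (subset_insert _ _) (fun u hu => hU'U u (mem_filter.1 hu).1)
      fun v hv => ⟨x, mem_insert_self _ _, (mem_filter.1 hv).2⟩
    refine ⟨insert x K, insert_subset (mem_sdiff.2 ⟨hxX, hxF⟩) hKX,
      hK.insert_of_adj hy hxy.symm, ?_, ?_⟩
    · rw [card_insert_of_notMem hxK]
      omega
    · rw [card_insert_of_notMem hxK]
      have h1 : 8 * #X * (#(seen H X K) + #{u ∈ U' | H.Adj u x}) ≤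
          8 * #X * #(seen H X (insert x K)) := Nat.mul_le_mul_left _ hgain
      nlinarith

/-- A highly connected set `X` has, outside any small set `F`, a small connected subset that sees
all but fewer than `k` vertices of `X`. -/
theorem exists_small_connected {V : Type*} {H : SimpleGraph V} {k : ℕ} {X F : Finset V}
    (hX : IsHighlyConnected H k X) (hk : k < #X) (hk0 : 0 < k) (hF : 4 * #F ≤ k) :
    ∃ K ⊆ X \ F, IsWalkConnected H K ∧ k ^ 2 * #K ≤ k ^ 2 + 8 * #X * #X ∧
      #(X \ seen H X K) < k := by
  let P : Finset V → Prop := fun K => K.Nonempty ∧ IsWalkConnected H K ∧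
    k ^ 2 * #K ≤ k ^ 2 + 8 * #X * #(seen H X K)
  have hne : ({K ∈ (X \ F).powerset | P K}).Nonempty := by
    have h1 := le_card_sdiff F X
    obtain ⟨x, hx⟩ := card_pos.1 (show 0 < #(X \ F) by omega)
    refine ⟨{x}, mem_filter.2 ⟨by simpa using hx, by simp, ?_, by simp⟩⟩
    intro a ha b hb
    rw [mem_singleton] at ha hb
    subst ha hb
    exact ⟨.nil, by simp⟩
  obtain ⟨K, hK, hmax⟩ := exists_max_image _ card hne
  obtain ⟨hKX, hKne, hKc, hKb⟩ := mem_filter.1 hK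
  rw [mem_powerset] at hKX
  refine ⟨K, hKX, hKc, hKb.trans ?_, ?_⟩
  · exact Nat.add_le_add_left (Nat.mul_le_mul_left _ (card_le_card (filter_subset _ _))) _
  · by_contra! hU
    obtain ⟨K', hK'X, hK'c, hlt, hK'b⟩ := exists_growth hX hk hk0 hF hKX hKne hKc hU
    refine absurd (hmax K' (mem_filter.2 ⟨mem_powerset.2 hK'X, card_pos.1 (by omega), hK'c, ?_⟩))
      (by omega)
    omega

/-- Sets that exist outside any set of at most `m` vertices can be chosen disjointly. -/
theorem exists_disjoint_choice {V ι : Type*} {Q : ι → Finset V → Prop} {s m : ℕ} (I : Finset ι)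
    (hI : #I * s ≤ m)
    (hQ : ∀ i ∈ I, ∀ F : Finset V, #F ≤ m → ∃ K, Disjoint K F ∧ #K ≤ s ∧ Q i K) :
    ∃ K : ι → Finset V, (∀ i ∈ I, #(K i) ≤ s ∧ Q i (K i)) ∧
      ∀ i ∈ I, ∀ j ∈ I, i ≠ j → Disjoint (K i) (K j) := by
  induction I using Finset.induction_on with
  | empty => exact ⟨fun _ => ∅, by simp, by simp⟩
  | insert i I hi ih =>
    rw [card_insert_of_notMem hi] at hI
    have hIs : #I * s ≤ m := (Nat.mul_le_mul_right _ (Nat.le_succ _)).trans hI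
    obtain ⟨K, hK, hKd⟩ := ih hIs fun j hj => hQ j (mem_insert_of_mem hj)
    obtain ⟨L, hLF, hLs, hL⟩ := hQ i (mem_insert_self _ _) (I.biUnion K)
      ((card_biUnion_le_card_mul _ _ _ fun j hj => (hK j hj).1).trans hIs)
    have hLK : ∀ j ∈ I, Disjoint L (K j) := (disjoint_biUnion_right _ _ _).1 hLF
    have hne : ∀ j ∈ I, j ≠ i := fun j hj h => hi (h ▸ hj)
    refine ⟨Function.update K i L, fun j hj => ?_, fun j hj j' hj' hjj' => ?_⟩
    · rcases mem_insert.1 hj with rfl | hj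
      · simpa using ⟨hLs, hL⟩
      · simpa [hne j hj] using hK j hj
    · rcases mem_insert.1 hj with rfl | hjI <;> rcases mem_insert.1 hj' with rfl | hjI'
      · exact absurd rfl hjj'
      · simpa [hne j' hjI'] using hLK j' hjI'
      · simpa [hne j hjI] using (hLK j hjI).symm
      · simpa [hne j hjI, hne j' hjI'] using hKd j hjI j' hjI' hjj'

/-! ### Packing long paths into few label classes -/

/-- The vertices of the paths in a family of labelled vertex sets. -/
noncomputable def covered {V ι : Type*} (Q : Finset (ι × Finset V)) : Finset V :=
  Q.biUnion Prod.snd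

/-- A family of disjoint paths in `W` with at least `g` vertices. A path with label `i` is a path
of the graph `H i` through vertices that satisfy `p i`. -/
structure IsPathPacking {V ι : Type*} (H : ι → SimpleGraph V) (p : ι → V → Prop) (g : ℕ)
    (W : Finset V) (C : Finset ι) (Q : Finset (ι × Finset V)) : Prop where
  label_mem : ∀ q ∈ Q, q.1 ∈ C
  subset : ∀ q ∈ Q, q.2 ⊆ W
  label : ∀ q ∈ Q, ∀ v ∈ q.2, p q.1 v
  isPathSet : ∀ q ∈ Q, IsPathSet (H q.1) q.2
  le_card : ∀ q ∈ Q, g ≤ #q.2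
  disjoint : ∀ q ∈ Q, ∀ q' ∈ Q, q ≠ q' → Disjoint q.2 q'.2

/-- A maximal packing leaves no long path in any of the label classes, hence, after the removal of
a few more vertices, only small degrees. -/
theorem exists_packing {V ι : Type*} (H : ι → SimpleGraph V) (p : ι → V → Prop) {g : ℕ}
    (hg : 0 < g) (e : ℕ) (W : Finset V) (C : Finset ι) :
    ∃ Q, IsPathPacking H p g W C Q ∧ ∃ L ⊆ W \ covered Q,
      e * #((W \ covered Q) \ L) ≤ #C * (2 * (g * #W)) ∧
      ∀ i ∈ C, ∀ u ∈ L, p i u → #{v ∈ L | p i v ∧ (H i).Adj u v} ≤ e := by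
  have hne : ({Q ∈ (C ×ˢ W.powerset).powerset | IsPathPacking H p g W C Q}).Nonempty :=
    ⟨∅, mem_filter.2 ⟨by simp, by constructor <;> simp⟩⟩
  obtain ⟨Q, hQ, hmax⟩ := exists_max_image _ card hne
  obtain ⟨hQsub, hQ⟩ := mem_filter.1 hQ
  have hshort : ∀ i ∈ C, ∀ S ⊆ {v ∈ W \ covered Q | p i v}, IsPathSet (H i) S → #S < g := by
    intro i hi S hS hpath
    by_contra! hgS
    have hSW : S ⊆ W := fun v hv => (mem_sdiff.1 (mem_filter.1 (hS hv)).1).1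
    have hSQ : ∀ q ∈ Q, Disjoint S q.2 := fun q hq => disjoint_left.2 fun v hv hvq =>
      (mem_sdiff.1 (mem_filter.1 (hS hv)).1).2 (mem_biUnion.2 ⟨q, hq, hvq⟩)
    have hnew : (i, S) ∉ Q := fun h => by
      have h1 := disjoint_self.1 (hSQ _ h)
      rw [bot_eq_empty] at h1
      rw [h1, card_empty] at hgS
      omega
    have hins : IsPathPacking H p g W C (insert (i, S) Q) := by
      constructor
      · exact (forall_mem_insert _ _ _).2 ⟨hi, hQ.label_mem⟩
      · exact (forall_mem_insert _ _ _).2 ⟨hSW, hQ.subset⟩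
      · exact (forall_mem_insert _ _ _).2 ⟨fun v hv => (mem_filter.1 (hS hv)).2, hQ.label⟩
      · exact (forall_mem_insert _ _ _).2 ⟨hpath, hQ.isPathSet⟩
      · exact (forall_mem_insert _ _ _).2 ⟨hgS, hQ.le_card⟩
      · refine (forall_mem_insert _ _ _).2 ⟨(forall_mem_insert _ _ _).2
          ⟨fun h => absurd rfl h, fun q hq _ => hSQ q hq⟩, fun q hq => ?_⟩
        exact (forall_mem_insert _ _ _).2 ⟨fun _ => (hSQ q hq).symm, hQ.disjoint q hq⟩
    have h1 := hmax (insert (i, S) Q) (mem_filter.2 ⟨mem_powerset.2 (insert_subset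
      (mem_product.2 ⟨hi, mem_powerset.2 hSW⟩) (mem_powerset.1 hQsub)), hins⟩)
    rw [card_insert_of_notMem hnew] at h1
    omega
  let D : ι → Finset V := fun i => {v ∈ W \ covered Q | p i v}
  let B : ι → Finset V := fun i => {u ∈ D i | e ≤ #{v ∈ D i | (H i).Adj u v}}
  refine ⟨Q, hQ, (W \ covered Q) \ C.biUnion B, sdiff_subset, ?_, ?_⟩
  · have hB : ∀ i ∈ C, e * #(B i) ≤ 2 * (g * #W) := fun i hi => by
      refine mul_card_high_degree_le.trans
        ((pairCount_adj_le_of_no_long_path (D i) (hshort i hi)).trans ?_)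
      exact Nat.mul_le_mul_left _ (Nat.mul_le_mul_left _
        (card_le_card ((filter_subset _ _).trans sdiff_subset)))
    have h1 : #((W \ covered Q) \ ((W \ covered Q) \ C.biUnion B)) ≤ ∑ i ∈ C, #(B i) :=
      (card_le_card fun v hv => by
        by_contra h
        exact (mem_sdiff.1 hv).2 (mem_sdiff.2 ⟨(mem_sdiff.1 hv).1, h⟩)).trans card_biUnion_le
    calc e * #((W \ covered Q) \ ((W \ covered Q) \ C.biUnion B))
        ≤ e * ∑ i ∈ C, #(B i) := Nat.mul_le_mul_left _ h1
      _ = ∑ i ∈ C, e * #(B i) := mul_sum _ _ _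
      _ ≤ #C * (2 * (g * #W)) := by
        rw [← smul_eq_mul #C]
        exact sum_le_card_nsmul _ _ _ hB
  · intro i hi u hu hpu
    obtain ⟨huW, huB⟩ := mem_sdiff.1 hu
    have huD : u ∈ D i := mem_filter.2 ⟨huW, hpu⟩
    have h1 : #{v ∈ D i | (H i).Adj u v} < e := by
      by_contra! h
      exact huB (mem_biUnion.2 ⟨i, hi, mem_filter.2 ⟨huD, h⟩⟩)
    refine (card_le_card fun v hv => ?_).trans h1.le
    obtain ⟨hv, hpv, huv⟩ := mem_filter.1 hv
    exact mem_filter.2 ⟨mem_filter.2 ⟨(mem_sdiff.1 hv).1, hpv⟩, huv⟩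

theorem card_filter_or_le {V : Type*} (L : Finset V) (p q r : V → Prop) [DecidablePred p]
    [DecidablePred q] [DecidablePred r] {a b : ℕ}
    (hp : #{v ∈ L | p v} ≤ a) (hq : #{v ∈ L | q v} ≤ b) (h : ∀ v ∈ L, r v → p v ∨ q v) :
    #{v ∈ L | r v} ≤ a + b := by
  have h1 : {v ∈ L | r v} ⊆ {v ∈ L | p v} ∪ {v ∈ L | q v} := fun v hv => by
    obtain ⟨hvL, hv⟩ := mem_filter.1 hv
    exact (h v hvL hv).elim (fun h => mem_union_left _ (mem_filter.2 ⟨hvL, h⟩))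
      fun h => mem_union_right _ (mem_filter.2 ⟨hvL, h⟩)
  exact (card_le_card h1).trans ((card_union_le _ _).trans (Nat.add_le_add hp hq))

/-- Long disjoint monochromatic paths with at most `2 * α` labels cover almost all of `S`. At most
`α` labels cover almost all vertices by `exists_label_cover`. After paths have been packed into
these classes, two adjacent remaining vertices mostly share a label outside the cover, so that
another `α` labels are enough for the remainder. -/
theorem exists_path_packing {V κ : Type*} {G : SimpleGraph V} {H : Fin 2 → SimpleGraph V}
    (hGH : ∀ u v, G.Adj u v → ∃ c, (H c).Adj u v) {S : Finset V} {α e g : ℕ} (hg : 0 < g)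
    (hα : ∀ T ⊆ S, G.IsIndepSet (T : Set V) → #T ≤ α) (lab : Fin 2 → V → κ)
    (he : ∀ c, ∀ u ∈ S, #{v ∈ S | (H c).Adj u v ∧ lab c u ≠ lab c v} ≤ e) :
    ∃ (C : Finset (Fin 2 × κ)) (Q : Finset ((Fin 2 × κ) × Finset V)), #C ≤ 2 * α ∧
      IsPathPacking (fun i => H i.1) (fun i v => lab i.1 v = i.2) g S C Q ∧
      e * #(S \ covered Q) ≤
        e * (2 ^ (α + 1) * (12 * e) + α) + 2 * (α * (2 * (g * #S))) := by
  obtain ⟨I, J, hIJ, hcov⟩ := exists_label_cover (e := e + e) hα (lab 0) (lab 1) fun u hu =>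
    card_filter_or_le _ _ _ _ (he 0 u hu) (he 1 u hu) fun v _ ⟨huv, h0, h1⟩ => by
      obtain ⟨c, hc⟩ := hGH u v huv
      fin_cases c
      exacts [Or.inl ⟨hc, h0⟩, Or.inr ⟨hc, h1⟩]
  set S₂ := {v ∈ S | lab 0 v ∈ I ∨ lab 1 v ∈ J} with hS₂
  have hS₂S : S₂ ⊆ S := filter_subset _ _
  set C₁ : Finset (Fin 2 × κ) := I.image (fun x => (0, x)) ∪ J.image (fun x => (1, x)) with hC₁
  have hC₁card : #C₁ ≤ α := (card_union_le _ _).trans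
    ((Nat.add_le_add card_image_le card_image_le).trans hIJ)
  have hC₁0 : ∀ x, (0, x) ∈ C₁ ↔ x ∈ I := by simp [hC₁]
  have hC₁1 : ∀ x, (1, x) ∈ C₁ ↔ x ∈ J := by simp [hC₁]
  obtain ⟨Q₁, hQ₁, L₁, hL₁, hL₁card, hL₁deg⟩ :=
    exists_packing (fun i : Fin 2 × κ => H i.1) (fun i v => lab i.1 v = i.2) hg e S₂ C₁
  have hL₁S : L₁ ⊆ S := (hL₁.trans sdiff_subset).trans hS₂S
  -- few edges are left inside the classes into which paths have been packed
  have hdeg : ∀ (L : Finset V) (C : Finset (Fin 2 × κ)),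
      (∀ i ∈ C, ∀ u ∈ L, lab i.1 u = i.2 →
        #{v ∈ L | lab i.1 v = i.2 ∧ (H i.1).Adj u v} ≤ e) → ∀ c, ∀ u ∈ L,
        #{v ∈ L | (H c).Adj u v ∧ lab c u = lab c v ∧ (c, lab c u) ∈ C} ≤ e := by
    intro L C h c u hu
    by_cases hC : (c, lab c u) ∈ C
    · refine (card_le_card fun v hv => ?_).trans (h _ hC u hu rfl)
      obtain ⟨hvL, huv, hl, -⟩ := mem_filter.1 hv
      exact mem_filter.2 ⟨hvL, hl.symm, huv⟩
    · simp [hC]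
  have hbad : ∀ c, ∀ L ⊆ L₁, ∀ u ∈ L, #{v ∈ L | (H c).Adj u v ∧
      (lab c u ≠ lab c v ∨ (c, lab c u) ∈ C₁)} ≤ e + e := by
    intro c L hL u hu
    refine (card_le_card (filter_subset_filter _ hL)).trans ?_
    refine card_filter_or_le _ _ _ _ ((card_le_card (filter_subset_filter _ hL₁S)).trans
      (he c u (hL₁S (hL hu)))) (hdeg L₁ C₁ hL₁deg c u (hL hu)) fun v _ ⟨huv, h⟩ => ?_
    by_cases hl : lab c u = lab c v
    · exact Or.inr ⟨huv, hl, h.resolve_left fun h => h hl⟩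
    · exact Or.inl ⟨huv, hl⟩
  -- up to the few edges of `hbad`, a red edge in `L₁` lies in a red class outside `I` and a blue one
  -- in a blue class outside `J`; as each vertex of `L₁` has at least one label in the cover, `l`
  -- picks out that class
  let l : V → Fin 2 × κ := fun v => if lab 0 v ∈ I then (1, lab 1 v) else (0, lab 0 v)
  have hl : ∀ c, ∀ u ∈ L₁, ∀ v ∈ L₁, (H c).Adj u v →
      ¬ (lab c u ≠ lab c v ∨ (c, lab c u) ∈ C₁) → l u = (c, lab c u) ∧ l v = (c, lab c u) := by
    intro c u hu v hv huv h
    rw [not_or, not_not] at h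
    have hu₂ := (mem_filter.1 (mem_sdiff.1 (hL₁ hu)).1).2
    have hv₂ := (mem_filter.1 (mem_sdiff.1 (hL₁ hv)).1).2
    have hc : c = 0 ∨ c = 1 := by omega
    rcases hc with rfl | rfl
    · rw [hC₁0] at h
      simp [l, ← h.1, h.2]
    · rw [hC₁1] at h
      rw [← h.1] at hv₂
      simp [l, ← h.1, hu₂.resolve_right h.2, hv₂.resolve_right h.2]
  obtain ⟨Λ, hΛ, hΛcov⟩ := exists_single_label_cover (e := (e + e) + (e + e))
    (fun T hT => hα T (hT.trans hL₁S)) l fun u hu =>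
      card_filter_or_le _ _ _ _ (hbad 0 L₁ le_rfl u hu) (hbad 1 L₁ le_rfl u hu)
        fun v hv ⟨huv, hne⟩ => by
          obtain ⟨c, hc⟩ := hGH u v huv
          have hb : lab c u ≠ lab c v ∨ (c, lab c u) ∈ C₁ := by
            by_contra hb
            obtain ⟨h1, h2⟩ := hl c u hu v hv hc hb
            exact hne (h1.trans h2.symm)
          have hc01 : c = 0 ∨ c = 1 := by omega
          rcases hc01 with rfl | rfl
          exacts [Or.inl ⟨hc, hb⟩, Or.inr ⟨hc, hb⟩]
  set S₃ := {v ∈ L₁ | l v ∈ Λ} with hS₃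
  have hS₃L : S₃ ⊆ L₁ := filter_subset _ _
  obtain ⟨Q₂, hQ₂, L₂, hL₂, hL₂card, hL₂deg⟩ :=
    exists_packing (fun i : Fin 2 × κ => H i.1) (fun i v => lab i.1 v = i.2) hg e S₃ Λ
  have hL₂S₃ : L₂ ⊆ S₃ := hL₂.trans sdiff_subset
  have hL₂L₁ : L₂ ⊆ L₁ := hL₂S₃.trans hS₃L
  have hL₂small : #L₂ ≤ 2 ^ (α + 1) * ((e + e + e) + (e + e + e)) + α := by
    have h3 : ∀ c, ∀ u ∈ L₂, #{v ∈ L₂ | (H c).Adj u v} ≤ e + e + e := fun c u hu =>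
      card_filter_or_le _ _ _ _ (hbad c L₂ hL₂L₁ u hu) (hdeg L₂ Λ hL₂deg c u hu)
        fun v hv huv => by
          by_cases hb : lab c u ≠ lab c v ∨ (c, lab c u) ∈ C₁
          · exact Or.inl ⟨huv, hb⟩
          · refine Or.inr ⟨huv, by_contra fun h => hb (Or.inl h), ?_⟩
            rw [← (hl c u (hL₂L₁ hu) v (hL₂L₁ hv) huv hb).1]
            exact (mem_filter.1 (hL₂S₃ hu)).2
    refine card_le_of_degree_le (fun T hT => hα T ((hT.trans hL₂L₁).trans hL₁S)) fun u hu =>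
      card_filter_or_le _ _ _ _ (h3 0 u hu) (h3 1 u hu) fun v _ huv => ?_
    obtain ⟨c, hc⟩ := hGH u v huv
    have hc01 : c = 0 ∨ c = 1 := by omega
    rcases hc01 with rfl | rfl
    exacts [Or.inl hc, Or.inr hc]
  have hQ₁₂ : ∀ q ∈ Q₁, ∀ q' ∈ Q₂, Disjoint q.2 q'.2 := fun q hq q' hq' =>
    disjoint_left.2 fun v hv hv' => (mem_sdiff.1 (hL₁ (hS₃L (hQ₂.subset q' hq' hv')))).2
      (mem_biUnion.2 ⟨q, hq, hv⟩)
  refine ⟨C₁ ∪ Λ, Q₁ ∪ Q₂, ?_, ?_, ?_⟩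
  · have := card_union_le C₁ Λ
    omega
  · constructor
    · exact fun q hq => (mem_union.1 hq).elim (fun h => mem_union_left _ (hQ₁.label_mem q h))
        fun h => mem_union_right _ (hQ₂.label_mem q h)
    · exact fun q hq => (mem_union.1 hq).elim (fun h => (hQ₁.subset q h).trans hS₂S)
        fun h => ((hQ₂.subset q h).trans hS₃L).trans hL₁S
    · exact fun q hq => (mem_union.1 hq).elim (hQ₁.label q) (hQ₂.label q)
    · exact fun q hq => (mem_union.1 hq).elim (hQ₁.isPathSet q) (hQ₂.isPathSet q)
    · exact fun q hq => (mem_union.1 hq).elim (hQ₁.le_card q) (hQ₂.le_card q)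
    · intro q hq q' hq' hne
      rcases mem_union.1 hq with h | h <;> rcases mem_union.1 hq' with h' | h'
      · exact hQ₁.disjoint q h q' h' hne
      · exact hQ₁₂ q h q' h'
      · exact (hQ₁₂ q' h' q h).symm
      · exact hQ₂.disjoint q h q' h' hne
  · have hsub : S \ covered (Q₁ ∪ Q₂) ⊆ {v ∈ S | lab 0 v ∉ I ∧ lab 1 v ∉ J} ∪
        ((S₂ \ covered Q₁) \ L₁) ∪ {v ∈ L₁ | l v ∉ Λ} ∪ ((S₃ \ covered Q₂) \ L₂) ∪ L₂ := by
      intro v hv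
      obtain ⟨hvS, hvQ⟩ := mem_sdiff.1 hv
      rw [covered, union_biUnion, mem_union, not_or] at hvQ
      by_cases hv₂ : v ∈ S₂
      swap
      · have h1 : lab 0 v ∉ I ∧ lab 1 v ∉ J := by
          rw [← not_or]
          exact fun h => hv₂ (mem_filter.2 ⟨hvS, h⟩)
        simp [hvS, h1]
      by_cases hv₃ : v ∈ L₁
      swap
      · have : v ∈ (S₂ \ covered Q₁) \ L₁ := mem_sdiff.2 ⟨mem_sdiff.2 ⟨hv₂, hvQ.1⟩, hv₃⟩
        simp only [mem_union, this, or_true, true_or]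
      by_cases hv₄ : v ∈ S₃
      swap
      · have : v ∈ {v ∈ L₁ | l v ∉ Λ} :=
          mem_filter.2 ⟨hv₃, fun h => hv₄ (mem_filter.2 ⟨hv₃, h⟩)⟩
        simp only [mem_union, this, or_true, true_or]
      by_cases hv₅ : v ∈ L₂
      · simp [hv₅]
      · have : v ∈ (S₃ \ covered Q₂) \ L₂ := mem_sdiff.2 ⟨mem_sdiff.2 ⟨hv₄, hvQ.2⟩, hv₅⟩
        simp only [mem_union, this, or_true, true_or]
    have h0 := card_le_card hsub
    have h1 := card_union_le ({v ∈ S | lab 0 v ∉ I ∧ lab 1 v ∉ J} ∪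
        ((S₂ \ covered Q₁) \ L₁) ∪ {v ∈ L₁ | l v ∉ Λ} ∪ ((S₃ \ covered Q₂) \ L₂)) L₂
    have h2 := card_union_le ({v ∈ S | lab 0 v ∉ I ∧ lab 1 v ∉ J} ∪
        ((S₂ \ covered Q₁) \ L₁) ∪ {v ∈ L₁ | l v ∉ Λ}) ((S₃ \ covered Q₂) \ L₂)
    have h3 := card_union_le ({v ∈ S | lab 0 v ∉ I ∧ lab 1 v ∉ J} ∪
        ((S₂ \ covered Q₁) \ L₁)) {v ∈ L₁ | l v ∉ Λ}
    have h4 := card_union_le {v ∈ S | lab 0 v ∉ I ∧ lab 1 v ∉ J} ((S₂ \ covered Q₁) \ L₁)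
    have h5 : #(S \ covered (Q₁ ∪ Q₂)) ≤ (2 ^ (α + 1) * (12 * e) + α) +
        #((S₂ \ covered Q₁) \ L₁) + #((S₃ \ covered Q₂) \ L₂) := by
      have : 2 ^ (α + 1) * (12 * e) = 2 ^ (α + 1) * (e + e) +
        2 ^ (α + 1) * ((e + e) + (e + e)) + 2 ^ (α + 1) * ((e + e + e) + (e + e + e)) := by ring
      omega
    have h6 : #C₁ * (2 * (g * #S₂)) ≤ α * (2 * (g * #S)) :=
      Nat.mul_le_mul hC₁card (Nat.mul_le_mul_left _ (Nat.mul_le_mul_left _ (card_le_card hS₂S)))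
    have h7 : #Λ * (2 * (g * #S₃)) ≤ α * (2 * (g * #S)) :=
      Nat.mul_le_mul hΛ (Nat.mul_le_mul_left _ (Nat.mul_le_mul_left _
        (card_le_card (hS₃L.trans hL₁S))))
    have h8 := Nat.mul_le_mul_left e h5
    rw [Nat.mul_add, Nat.mul_add] at h8
    linarith

/-! ### Connecting the paths -/

/-- The form of `exists_decomposition` in which degrees replace the number of edges. -/
theorem exists_connected_classes {V : Type*} [Fintype V] (H : SimpleGraph V) (d k e : ℕ) :
    ∃ (T : Finset V) (P : Finset (Finset V)),
      (∀ X ∈ P, d ≤ #X ∧ IsHighlyConnected H k X) ∧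
      (∀ X ∈ P, ∀ Y ∈ P, X ≠ Y → Disjoint X Y) ∧
      (∀ u ∉ T, #{v ∈ univ \ T | AdjAcross H P u v} ≤ e) ∧
      d * e * #T ≤ e * (k * Fintype.card V) + d * (2 * ((d + k) * Fintype.card V)) := by
  obtain ⟨T, -, P, hP, hPd, hT, hpairs⟩ := exists_decomposition H d k univ
  set D := {u ∈ univ \ T | e ≤ #{v ∈ univ \ T | AdjAcross H P u v}} with hD
  have hDc : e * #D ≤ 2 * ((d + k) * Fintype.card V) := mul_card_high_degree_le.trans hpairs
  have hTc : d * #T ≤ k * Fintype.card V := hT.trans (Nat.mul_le_mul_left _ (Nat.sub_le _ _))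
  refine ⟨T ∪ D, P, fun X hX => (hP X hX).2, hPd, fun u hu => ?_, ?_⟩
  · rw [mem_union, not_or] at hu
    by_contra! h
    refine hu.2 (mem_filter.2 ⟨by simpa using hu.1, h.le.trans (card_le_card ?_)⟩)
    exact filter_subset_filter _ (sdiff_subset_sdiff le_rfl subset_union_left)
  · calc d * e * #(T ∪ D) ≤ d * e * (#T + #D) := Nat.mul_le_mul_left _ (card_union_le _ _)
      _ = e * (d * #T) + d * (e * #D) := by ring
      _ ≤ _ := Nat.add_le_add (Nat.mul_le_mul_left _ hTc) (Nat.mul_le_mul_left _ hDc)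

/-- Disjoint sets with at least `d` vertices are few. -/
theorem card_le_of_disjoint {V ι : Type*} [Fintype V] {P : Finset ι} {f : ι → Finset V} {d M : ℕ}
    (hd : 0 < d) (hM : Fintype.card V ≤ M * d) (hP : ∀ i ∈ P, d ≤ #(f i))
    (hdisj : ∀ i ∈ P, ∀ j ∈ P, i ≠ j → Disjoint (f i) (f j)) : #P ≤ M := by
  have h1 : #P * d ≤ ∑ i ∈ P, #(f i) := by
    rw [← smul_eq_mul]
    exact card_nsmul_le_sum _ _ _ hP
  have h2 : ∑ i ∈ P, #(f i) = #(P.biUnion f) := (card_biUnion hdisj).symm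
  have h3 : #(P.biUnion f) ≤ Fintype.card V := card_le_univ _
  exact Nat.le_of_mul_le_mul_right (by omega : #P * d ≤ M * d) hd

/-- For every colour and every class `X` of that colour, `M` connecting sets can be reserved, all
of them disjoint. Outside a small set `B` that includes them, all vertices of `X` have a neighbour
in each of the connecting sets of `X`. -/
theorem exists_connectors {V : Type*} [Fintype V] {H : Fin 2 → SimpleGraph V}
    {P : Fin 2 → Finset (Finset V)} {d k M s : ℕ} (hk : 0 < k) (hkd : k < d)
    (hP : ∀ c, ∀ X ∈ P c, d ≤ #X ∧ IsHighlyConnected (H c) k X) (hPM : ∀ c, #(P c) ≤ M)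
    (hs : k ^ 2 + 8 * Fintype.card V * Fintype.card V < k ^ 2 * (s + 1))
    (hsk : 4 * (2 * M * M * s) ≤ k) :
    ∃ (K : Fin 2 × Finset V → ℕ → Finset V) (B : Finset V),
      (∀ c, ∀ X ∈ P c, ∀ j < M, IsWalkConnected (H c) (K (c, X) j) ∧ K (c, X) j ⊆ B ∧
        ∀ v ∈ X, v ∉ B → ∃ x ∈ K (c, X) j, (H c).Adj v x) ∧
      (∀ c, ∀ X ∈ P c, ∀ j < M, ∀ c', ∀ X' ∈ P c', ∀ j' < M, ((c, X), j) ≠ ((c', X'), j') →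
        Disjoint (K (c, X) j) (K (c', X') j')) ∧ #B ≤ k + 2 * M * M * k := by
  let Λ : Finset (Fin 2 × Finset V) := univ.biUnion fun c => (P c).image (Prod.mk c)
  have hΛ : ∀ c X, (c, X) ∈ Λ ↔ X ∈ P c := by
    intro c X
    simp only [Λ, mem_biUnion, mem_univ, true_and, mem_image, Prod.mk.injEq]
    constructor
    · rintro ⟨c', X', h, rfl, rfl⟩
      exact h
    · exact fun h => ⟨c, X, h, rfl, rfl⟩
  have hΛc : #Λ ≤ 2 * M := by
    have := card_biUnion_le_card_mul (univ : Finset (Fin 2)) (fun c => (P c).image (Prod.mk c)) M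
      fun c _ => card_image_le.trans (hPM c)
    simpa using this
  let I := Λ ×ˢ range M
  have hI : #I ≤ 2 * M * M := by
    rw [card_product, card_range]
    exact Nat.mul_le_mul_right _ hΛc
  have hmem : ∀ {c X j}, X ∈ P c → j < M → ((c, X), j) ∈ I := fun hX hj =>
    mem_product.2 ⟨(hΛ _ _).2 hX, mem_range.2 hj⟩
  have hmem' : ∀ i ∈ I, i.1.2 ∈ P i.1.1 := fun i hi => (hΛ _ _).1 (mem_product.1 hi).1
  obtain ⟨K, hK, hKd⟩ := exists_disjoint_choice (s := s) (m := 2 * M * M * s)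
    (Q := fun i L => IsWalkConnected (H i.1.1) L ∧ #(i.1.2 \ seen (H i.1.1) i.1.2 L) < k) I
    (Nat.mul_le_mul_right _ hI) fun i hi F hF => by
      obtain ⟨hdX, hX⟩ := hP _ _ (hmem' i hi)
      obtain ⟨L, hL, hLc, hLs, hLk⟩ := exists_small_connected (F := F) hX (by omega) hk (by omega)
      refine ⟨L, disjoint_left.2 fun v hv => (mem_sdiff.1 (hL hv)).2, ?_, hLc, hLk⟩
      have h1 : k ^ 2 * #L < k ^ 2 * (s + 1) := by
        refine (hLs.trans (Nat.add_le_add_left ?_ _)).trans_lt hs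
        have := card_le_univ i.1.2
        exact Nat.mul_le_mul (Nat.mul_le_mul_left _ this) this
      exact Nat.lt_succ_iff.1 (Nat.lt_of_mul_lt_mul_left h1)
  refine ⟨fun i j => K (i, j),
    I.biUnion K ∪ I.biUnion fun i => i.1.2 \ seen (H i.1.1) i.1.2 (K i), ?_, ?_, ?_⟩
  · intro c X hX j hj
    have hi := hmem hX hj
    refine ⟨(hK _ hi).2.1, (subset_biUnion_of_mem K hi).trans subset_union_left,
      fun v hv hvB => ?_⟩
    rw [mem_union, not_or] at hvB
    have hvK : v ∉ K ((c, X), j) := fun h => hvB.1 (mem_biUnion.2 ⟨_, hi, h⟩)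
    have hvs : v ∈ seen (H c) X (K ((c, X), j)) := by
      by_contra h
      exact hvB.2 (mem_biUnion.2 ⟨_, hi, mem_sdiff.2 ⟨hv, h⟩⟩)
    exact (mem_filter.1 hvs).2.resolve_left hvK
  · exact fun c X hX j hj c' X' hX' j' hj' hne => hKd _ (hmem hX hj) _ (hmem hX' hj') hne
  · have h1 : #(I.biUnion K) ≤ #I * s := card_biUnion_le_card_mul _ _ _ fun i hi => (hK i hi).1
    have h2 : #(I.biUnion fun i => i.1.2 \ seen (H i.1.1) i.1.2 (K i)) ≤ #I * k :=
      card_biUnion_le_card_mul _ _ _ fun i hi => (hK i hi).2.2.le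
    have h3 := Nat.mul_le_mul_right s hI
    have h4 := Nat.mul_le_mul_right k hI
    refine (card_union_le _ _).trans ?_
    omega

/-- The member of `P` that contains `v`, or else the singleton `{v}`. -/
noncomputable def partLabel {V : Type*} (P : Finset (Finset V)) (v : V) : Finset V :=
  if h : ∃ X ∈ P, v ∈ X then h.choose else {v}

theorem mem_partLabel {V : Type*} (P : Finset (Finset V)) (v : V) : v ∈ partLabel P v := by
  unfold partLabel
  split_ifs with h
  · exact h.choose_spec.2
  · simp

theorem partLabel_eq {V : Type*} {P : Finset (Finset V)}
    (hP : ∀ X ∈ P, ∀ Y ∈ P, X ≠ Y → Disjoint X Y) {X : Finset V} (hX : X ∈ P) {v : V}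
    (hv : v ∈ X) : partLabel P v = X := by
  have h : ∃ X ∈ P, v ∈ X := ⟨X, hX, hv⟩
  rw [partLabel, dif_pos h]
  by_contra hne
  exact disjoint_left.1 (hP _ h.choose_spec.1 X hX hne) h.choose_spec.2 hv

theorem partLabel_mem {V : Type*} {P : Finset (Finset V)} {u v : V} (huv : u ≠ v)
    (h : partLabel P u = partLabel P v) : partLabel P u ∈ P := by
  have hv := mem_partLabel P v
  rw [← h] at hv
  unfold partLabel at hv ⊢
  split_ifs at hv ⊢ with hu
  · exact hu.choose_spec.1
  · exact absurd (mem_singleton.1 hv).symm huv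

/-- Disjoint monochromatic cycles, at most `2 * α` of them, together with a bound for the number
of vertices that they miss. -/
theorem exists_cycles {V : Type*} [Fintype V] {G : SimpleGraph V} {H : Fin 2 → SimpleGraph V}
    (hGH : ∀ u v, G.Adj u v → ∃ c, (H c).Adj u v) {α d k e M s : ℕ}
    (hα : ∀ T : Finset V, G.IsIndepSet (T : Set V) → #T ≤ α) (hk : 0 < k) (hkd : k < d)
    (hM : Fintype.card V ≤ M * d)
    (hs : k ^ 2 + 8 * Fintype.card V * Fintype.card V < k ^ 2 * (s + 1))
    (hsk : 4 * (2 * M * M * s) ≤ k) :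
    ∃ (C : Finset (Fin 2 × Finset V)) (Y : Fin 2 × Finset V → Finset V), #C ≤ 2 * α ∧
      (∀ i ∈ C, Y i = ∅ ∨ ∃ (v : V) (p : (H i.1).Walk v v), p.IsCycle ∧
        p.support.toFinset = Y i) ∧
      (∀ i ∈ C, ∀ j ∈ C, i ≠ j → Disjoint (Y i) (Y j)) ∧
      d * e * #(univ \ C.biUnion Y) ≤
        2 * (e * (k * Fintype.card V) + d * (2 * ((d + k) * Fintype.card V))) +
        d * e * (k + 2 * M * M * k) +
        d * (e * (2 ^ (α + 1) * (12 * e) + α) + 2 * (α * (2 * (d * Fintype.card V)))) := by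
  have hd : 0 < d := hk.trans hkd
  choose T P hP hPd hPe hT using fun c => exists_connected_classes (H c) d k e
  have hPM : ∀ c, #(P c) ≤ M := fun c =>
    card_le_of_disjoint (f := id) hd hM (fun X hX => (hP c X hX).1) (hPd c)
  obtain ⟨K, B, hK, hKd, hB⟩ := exists_connectors hk hkd hP hPM hs hsk
  set S : Finset V := univ \ (T 0 ∪ T 1 ∪ B) with hS
  have hST : ∀ c, ∀ v ∈ S, v ∉ T c := by
    intro c v hv
    simp only [hS, mem_sdiff, mem_univ, mem_union, true_and, not_or] at hv
    have hc : c = 0 ∨ c = 1 := by omega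
    rcases hc with rfl | rfl
    exacts [hv.1.1, hv.1.2]
  have hSB : ∀ v ∈ S, v ∉ B := fun v hv h => (mem_sdiff.1 hv).2 (mem_union_right _ h)
  have hlab : ∀ c, ∀ u ∈ S, #{v ∈ S | (H c).Adj u v ∧
      partLabel (P c) u ≠ partLabel (P c) v} ≤ e := by
    intro c u hu
    refine (card_le_card fun v hv => ?_).trans (hPe c u (hST c u hu))
    obtain ⟨hvS, huv, hne⟩ := mem_filter.1 hv
    refine mem_filter.2 ⟨by simpa using hST c v hvS, huv, fun ⟨X, hX, huX, hvX⟩ => hne ?_⟩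
    rw [partLabel_eq (hPd c) hX huX, partLabel_eq (hPd c) hX hvX]
  obtain ⟨C, Q, hC, hQ, hQcov⟩ := exists_path_packing (S := S) (e := e) hGH hd (fun T _ => hα T)
    (fun c => partLabel (P c)) fun c u hu => by convert hlab c u hu
  have hQM : #Q ≤ M := card_le_of_disjoint (f := Prod.snd) hd hM hQ.le_card hQ.disjoint
  let F : Fin 2 × Finset V → Finset (Finset V) := fun i => {q ∈ Q | q.1 = i}.image Prod.snd
  have hF : ∀ i, ∀ A ∈ F i, (i, A) ∈ Q := by
    intro i A hA
    obtain ⟨⟨j, A'⟩, hq, rfl⟩ := mem_image.1 hA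
    obtain ⟨hqQ, rfl⟩ := mem_filter.1 hq
    exact hqQ
  have hFlabel : ∀ i, ∀ A ∈ F i, i.2 ∈ P i.1 := by
    intro i A hA
    have h2 : 1 < #A := by
      have := hQ.le_card _ (hF i A hA)
      simp only at this
      omega
    obtain ⟨u, hu, v, hv, huv⟩ := one_lt_card.1 h2
    have hu' : partLabel (P i.1) u = i.2 := hQ.label _ (hF i A hA) u hu
    have hv' : partLabel (P i.1) v = i.2 := hQ.label _ (hF i A hA) v hv
    rw [← hu']
    exact partLabel_mem huv (hu'.trans hv'.symm)
  have hFS : ∀ i, (F i).biUnion id ⊆ S := fun i =>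
    biUnion_subset.2 fun A hA => hQ.subset _ (hF i A hA)
  have hcycle : ∀ i, ∃ Y : Finset V, (Y = ∅ ∨ ∃ (v : V) (p : (H i.1).Walk v v), p.IsCycle ∧
      p.support.toFinset = Y) ∧ (F i).biUnion id ⊆ Y ∧ ∀ v ∈ Y, v ∈ (F i).biUnion id ∨
        i.2 ∈ P i.1 ∧ ∃ j < M, v ∈ K i j := by
    rintro ⟨c, X⟩
    rcases (F (c, X)).eq_empty_or_nonempty with hempty | hne
    · exact ⟨∅, Or.inl rfl, by simp [hempty], by simp⟩
    obtain ⟨A₀, hA₀⟩ := hne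
    have hX : X ∈ P c := hFlabel _ A₀ hA₀
    obtain ⟨v, p, hp, hFp, hpK⟩ := exists_cycle_through_paths (H := H c)
      (T := (F (c, X)).biUnion id) (K := K (c, X)) (M := M) (fun j hj => (hK c X hX j hj).1)
      (fun i hi j hj hij => hKd c X hX i hi c X hX j hj (by simpa using hij))
      (fun j hj => disjoint_left.2 fun v hv hvK => hSB v (hFS _ hv) ((hK c X hX j hj).2.1 hvK))
      (fun j hj v hv => by
        refine (hK c X hX j hj).2.2 v ?_ (hSB v (hFS _ hv))
        obtain ⟨A, hA, hvA⟩ := mem_biUnion.1 hv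
        have h : partLabel (P c) v = X := hQ.label _ (hF _ A hA) v hvA
        rw [← h]
        exact mem_partLabel _ v)
      (F (c, X)) ⟨A₀, hA₀⟩ ((card_image_le.trans (card_le_card (filter_subset _ _))).trans hQM)
      (fun A hA => subset_biUnion_of_mem id hA) (fun A hA => hQ.isPathSet _ (hF _ A hA))
      (fun A hA A' hA' hne => hQ.disjoint _ (hF _ A hA) _ (hF _ A' hA')
        fun h => hne (Prod.ext_iff.1 h).2)
      (fun A hA => by
        have := hQ.le_card _ (hF _ A hA)
        simp only at this
        omega)
    refine ⟨_, Or.inr ⟨v, p, hp, rfl⟩, hFp, fun w hw => ?_⟩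
    refine (mem_union.1 (hpK hw)).imp_right fun h => ⟨hX, ?_⟩
    obtain ⟨j, hj, hwj⟩ := mem_biUnion.1 h
    exact ⟨j, mem_range.1 hj, hwj⟩
  choose Y hYc hFY hYK using hcycle
  refine ⟨C, Y, hC, fun i _ => hYc i, fun i _ j _ hij => disjoint_left.2 fun v hvi hvj => ?_, ?_⟩
  · rcases hYK i v hvi with h | ⟨hi, a, ha, hva⟩ <;> rcases hYK j v hvj with h' | ⟨hj, b, hb, hvb⟩
    · obtain ⟨A, hA, hvA⟩ := mem_biUnion.1 h
      obtain ⟨A', hA', hvA'⟩ := mem_biUnion.1 h'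
      exact disjoint_left.1 (hQ.disjoint _ (hF i A hA) _ (hF j A' hA')
        fun h => hij (Prod.ext_iff.1 h).1) hvA hvA'
    · exact hSB v (hFS i h) ((hK j.1 j.2 hj b hb).2.1 hvb)
    · exact hSB v (hFS j h') ((hK i.1 i.2 hi a ha).2.1 hva)
    · refine disjoint_left.1 (hKd i.1 i.2 hi a ha j.1 j.2 hj b hb fun h => hij ?_) hva hvb
      exact (Prod.ext_iff.1 h).1
  · have hsub : univ \ C.biUnion Y ⊆ T 0 ∪ T 1 ∪ B ∪ (S \ covered Q) := by
      intro v hv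
      by_cases hvS : v ∈ S
      · refine mem_union_right _ (mem_sdiff.2 ⟨hvS, fun h => ?_⟩)
        obtain ⟨q, hq, hvq⟩ := mem_biUnion.1 h
        refine (mem_sdiff.1 hv).2 (mem_biUnion.2 ⟨q.1, hQ.label_mem q hq, hFY q.1 ?_⟩)
        exact mem_biUnion.2 ⟨q.2, mem_image.2 ⟨q, mem_filter.2 ⟨hq, rfl⟩, rfl⟩, hvq⟩
      · refine mem_union_left _ ?_
        by_contra h
        exact hvS (mem_sdiff.2 ⟨mem_univ _, h⟩)
    have h1 : #(univ \ C.biUnion Y) ≤ #(T 0) + #(T 1) + #B + #(S \ covered Q) := by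
      have h1 := card_union_le (T 0 ∪ T 1 ∪ B) (S \ covered Q)
      have h2 := card_union_le (T 0 ∪ T 1) B
      have h3 := card_union_le (T 0) (T 1)
      have h4 := card_le_card hsub
      omega
    have hSn : #S ≤ Fintype.card V := card_le_univ _
    have h2 : e * #(S \ covered Q) ≤ e * (2 ^ (α + 1) * (12 * e) + α) +
        2 * (α * (2 * (d * Fintype.card V))) := hQcov.trans (by gcongr)
    have h3 := Nat.mul_le_mul_left d h2
    have h4 := Nat.mul_le_mul_left (d * e) hB
    have h5 := Nat.mul_le_mul_left (d * e) h1
    have h6 := hT 0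
    have h7 := hT 1
    rw [Nat.mul_add (d * e), Nat.mul_add (d * e), Nat.mul_add (d * e)] at h5
    rw [← mul_assoc d e] at h3
    linarith

/-! ### Choice of constants -/

/-- The errors of `exists_cycles` for `k = q`, `d = z * q` and `e = w * z * q` add up to at most
`n / N`, provided that `w` is large, `z` is larger and `n / q` is larger still. -/
theorem error_bound {N α a M w z q n U : ℕ} (hα : 0 < α) (hN : 0 < N) (hq : 0 < q)
    (hw : w = 100 * α * N) (hz : z = 100 * N * (1 + 2 * M * M))
    (hn : 100 * a * N * w * z * q ≤ n) (hzn : z * q ≤ n) (hαn : 10 * α * N ≤ n)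
    (hU : z * q * (w * z * q) * U ≤
      2 * (w * z * q * (q * n) + z * q * (2 * ((z * q + q) * n))) +
      z * q * (w * z * q) * (q + 2 * M * M * q) +
      z * q * (w * z * q * (a * (12 * (w * z * q)) + α) + 2 * (α * (2 * (z * q * n))))) :
    N * U ≤ n := by
  have hz0 : 0 < z := by rw [hz]; positivity
  have hw0 : 0 < w := by rw [hw]; positivity
  have hz100 : 100 * N ≤ z := by rw [hz]; exact Nat.le_mul_of_pos_right _ (by omega)
  have hw100 : 100 * N ≤ w := by
    rw [hw]
    exact Nat.mul_le_mul_right _ (Nat.le_mul_of_pos_right _ hα)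
  -- the factor `q ^ 2` cancels
  have h0 : w * z ^ 2 * U ≤ 2 * w * z * n + 4 * z * (z + 1) * n +
      w * z ^ 2 * (q * (1 + 2 * M * M)) + w * z ^ 2 * (12 * a * w * z * q + α) +
      4 * α * z ^ 2 * n := by
    refine Nat.le_of_mul_le_mul_left ?_ (show 0 < q ^ 2 by positivity)
    calc q ^ 2 * (w * z ^ 2 * U) = z * q * (w * z * q) * U := by ring
      _ ≤ _ := hU
      _ = _ := by ring
  -- in units of `w * z ^ 2 * n / (100 * N)` the errors are at most 2, 8, 1, 22 and 4
  have t1 : 100 * N * (2 * w * z * n) ≤ 2 * (w * z ^ 2 * n) :=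
    calc 100 * N * (2 * w * z * n) = 2 * w * z * n * (100 * N) := by ring
      _ ≤ 2 * w * z * n * z := Nat.mul_le_mul_left _ hz100
      _ = _ := by ring
  have t2 : 100 * N * (4 * z * (z + 1) * n) ≤ 8 * (w * z ^ 2 * n) :=
    calc 100 * N * (4 * z * (z + 1) * n) ≤ w * (4 * z * (z + z) * n) := by gcongr; omega
      _ = _ := by ring
  have t3 : 100 * N * (w * z ^ 2 * (q * (1 + 2 * M * M))) ≤ w * z ^ 2 * n :=
    calc 100 * N * (w * z ^ 2 * (q * (1 + 2 * M * M)))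
        = w * z ^ 2 * (100 * N * (1 + 2 * M * M) * q) := by ring
      _ = w * z ^ 2 * (z * q) := by rw [← hz]
      _ ≤ _ := Nat.mul_le_mul_left _ hzn
  have t4 : 100 * N * (w * z ^ 2 * (12 * a * w * z * q + α)) ≤ 22 * (w * z ^ 2 * n) :=
    calc 100 * N * (w * z ^ 2 * (12 * a * w * z * q + α))
        = w * z ^ 2 * (12 * (100 * a * N * w * z * q) + 10 * (10 * α * N)) := by ring
      _ ≤ w * z ^ 2 * (12 * n + 10 * n) := by gcongr
      _ = _ := by ring
  have t5 : 100 * N * (4 * α * z ^ 2 * n) ≤ 4 * (w * z ^ 2 * n) := by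
    rw [hw]
    exact le_of_eq (by ring)
  have h1 := Nat.mul_le_mul_left (100 * N) h0
  refine Nat.le_of_mul_le_mul_left (?_ : 100 * (w * z ^ 2) * (N * U) ≤ 100 * (w * z ^ 2) * n)
    (by positivity)
  simp only [Nat.mul_add (100 * N)] at h1
  have h2 : 0 ≤ w * z ^ 2 * n := Nat.zero_le _
  calc 100 * (w * z ^ 2) * (N * U) = 100 * N * (w * z ^ 2 * U) := by ring
    _ ≤ 37 * (w * z ^ 2 * n) := by linarith
    _ ≤ 100 * (w * z ^ 2) * n := by linarith

/-- All but a fraction `1 / N` of the vertices of a large graph are covered by disjoint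
monochromatic cycles. -/
theorem exists_cycles_of_large (α N : ℕ) (hα : 0 < α) (hN : 0 < N) :
    ∃ n₀ : ℕ, ∀ (V : Type*) [Fintype V] (G : SimpleGraph V) (H : Fin 2 → SimpleGraph V),
      n₀ ≤ Fintype.card V → (∀ u v, G.Adj u v → ∃ c, (H c).Adj u v) →
      (∀ T : Finset V, G.IsIndepSet (T : Set V) → #T ≤ α) →
      ∃ (C : Finset (Fin 2 × Finset V)) (Y : Fin 2 × Finset V → Finset V), #C ≤ 2 * α ∧
        (∀ i ∈ C, Y i = ∅ ∨ ∃ (v : V) (p : (H i.1).Walk v v), p.IsCycle ∧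
          p.support.toFinset = Y i) ∧
        (∀ i ∈ C, ∀ j ∈ C, i ≠ j → Disjoint (Y i) (Y j)) ∧
        N * #(univ \ C.biUnion Y) ≤ Fintype.card V := by
  -- the constants are generalized so that they stay opaque to the arithmetic tactics
  obtain ⟨a, ha⟩ : ∃ a, a = 2 ^ (α + 1) := ⟨_, rfl⟩
  obtain ⟨w, hw⟩ : ∃ w, w = 100 * α * N := ⟨_, rfl⟩
  obtain ⟨M, hM⟩ : ∃ M, M = 2 * (100 * a * N * w) := ⟨_, rfl⟩
  obtain ⟨z, hz⟩ : ∃ z, z = 100 * N * (1 + 2 * M * M) := ⟨_, rfl⟩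
  obtain ⟨R, hR⟩ : ∃ R, R = 100 * a * N * w * z := ⟨_, rfl⟩
  obtain ⟨s, hs⟩ : ∃ s, s = 32 * R ^ 2 + 1 := ⟨_, rfl⟩
  have ha0 : 0 < a := by rw [ha]; positivity
  have hw0 : 0 < w := by rw [hw]; positivity
  have hz2 : 2 ≤ z := by
    have : 100 * 1 * 1 ≤ z := by
      rw [hz]
      gcongr <;> omega
    omega
  have hR0 : 0 < R := by rw [hR]; positivity
  refine ⟨R * (4 * (2 * M * M * s) + 1) + 10 * α * N, fun V _ G H hn hGH hind => ?_⟩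
  set n := Fintype.card V
  obtain ⟨q, hq⟩ : ∃ q, q = n / R := ⟨_, rfl⟩
  have hqR : R * q ≤ n := hq ▸ Nat.mul_div_le n R
  have hnq : n < R * (q + 1) := hq ▸ Nat.lt_mul_div_succ n hR0
  have hqs : 4 * (2 * M * M * s) + 1 ≤ q := by
    rw [hq, Nat.le_div_iff_mul_le hR0, mul_comm]
    omega
  have hq0 : 0 < q := by omega
  have hn2 : n ≤ 2 * R * q := by
    have : R * (q + 1) ≤ R * (2 * q) := Nat.mul_le_mul_left _ (by omega)
    linarith
  obtain ⟨C, Y, hC, hY, hYd, hU⟩ := exists_cycles (d := z * q) (k := q) (e := w * z * q) (M := M)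
    (s := s) hGH hind hq0 (by nlinarith) (by
      refine hn2.trans (le_of_eq ?_)
      rw [hR, hM]
      ring) (by
      have h1 : n * n ≤ 2 * R * q * (2 * R * q) := Nat.mul_le_mul hn2 hn2
      have h2 : 0 < q ^ 2 := by positivity
      rw [hs]
      calc q ^ 2 + 8 * n * n = q ^ 2 + 8 * (n * n) := by ring
        _ ≤ q ^ 2 + 8 * (2 * R * q * (2 * R * q)) := by omega
        _ < q ^ 2 + 8 * (2 * R * q * (2 * R * q)) + q ^ 2 := by omega
        _ = _ := by ring) (by omega)
  refine ⟨C, Y, hC, hY, hYd, ?_⟩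
  rw [← ha] at hU
  refine error_bound hα hN hq0 hw hz (hR ▸ hqR) (le_trans ?_ hqR) (by omega) hU
  refine Nat.mul_le_mul_right _ ?_
  rw [hR]
  exact Nat.le_mul_of_pos_left _ (by positivity)

/-- A cycle of a colour graph is a monochromatic cycle of the graph. -/
theorem exists_monochromatic_cycle {V K : Type*} [Fintype V] {G : SimpleGraph V}
    (χ : G.EdgeLabeling K) (c : K) {v : V} {p : (χ.labelGraph c).Walk v v} (hp : p.IsCycle) :
    ∃ D : G.Subgraph, D.IsCycleSubgraph ∧ D.IsMonochromatic χ ∧ D.verts = p.support.toFinset := by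
  refine ⟨(p.mapLe χ.labelGraph_le).toSubgraph,
    Or.inr (Or.inr (Or.inr ⟨v, _, hp.mapLe _, rfl⟩)), ⟨c, fun e he => ?_⟩, ?_⟩
  · have he' : e ∈ p.edges := by
      rw [SimpleGraph.Walk.edgeSet_toSubgraph] at he
      simpa using he
    have h := p.edges_subset_edgeSet he'
    induction e using Sym2.ind with
    | _ x y =>
      obtain ⟨hG, hc⟩ := (SimpleGraph.EdgeLabeling.labelGraph_adj x y).1 h
      exact hc
  · ext w
    simp

end MonochromaticCover

theorem mainTheorem1 (η : ℝ) (hη : 0 < η) (α : ℕ) (hα : 0 < α) :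
    ∃ n₀ : ℕ, ∀ (V : Type*) [Fintype V] (G : SimpleGraph V) (χ : G.EdgeLabeling (Fin 2)),
      n₀ ≤ Fintype.card V → G.indepNum = α →
      ∃ (k : ℕ) (C : Fin k → G.Subgraph),
        k ≤ 2 * α ∧
        (∀ i, (C i).IsCycleSubgraph) ∧
        (∀ i, (C i).IsMonochromatic χ) ∧
        (∀ i j, i ≠ j → Disjoint (C i).verts (C j).verts) ∧
        (1 - η) * (Fintype.card V : ℝ) ≤ ((⋃ i, (C i).verts).ncard : ℝ) := by
  classical
  obtain ⟨N, hN⟩ := exists_nat_gt (1 / η)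
  have hN0 : 0 < (N : ℝ) := (by positivity : 0 < 1 / η).trans hN
  obtain ⟨n₀, hn₀⟩ := MonochromaticCover.exists_cycles_of_large α N hα (by exact_mod_cast hN0)
  refine ⟨n₀, fun V _ G χ hn hind => ?_⟩
  obtain ⟨I, Y, hI, hY, hYd, hU⟩ := hn₀ V G (fun c => χ.labelGraph c) hn
    (fun u v huv => ⟨χ ⟨s(u, v), huv⟩, (SimpleGraph.EdgeLabeling.labelGraph_adj u v).2 ⟨huv, rfl⟩⟩)
    fun T hT => hind ▸ hT.card_le_indepNum
  have hD : ∀ i ∈ I, ∃ D : G.Subgraph, D.IsCycleSubgraph ∧ D.IsMonochromatic χ ∧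
      D.verts = (Y i : Set V) := by
    intro i hi
    rcases hY i hi with h | ⟨v, p, hp, hpY⟩
    · exact ⟨⊥, Or.inl rfl, ⟨0, by simp⟩, by simp [h]⟩
    · obtain ⟨D, h1, h2, h3⟩ := MonochromaticCover.exists_monochromatic_cycle χ i.1 hp
      exact ⟨D, h1, h2, by rw [h3, ← hpY]⟩
  choose! D hDc hDm hDv using hD
  let f := I.equivFin.symm
  refine ⟨I.card, fun i => D (f i), hI, fun i => hDc _ (f i).2, fun i => hDm _ (f i).2,
    fun i j hij => ?_, ?_⟩
  · rw [hDv _ (f i).2, hDv _ (f j).2, Finset.disjoint_coe]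
    exact hYd _ (f i).2 _ (f j).2 fun h => hij (f.injective (Subtype.ext h))
  · have hverts : (⋃ i, (D (f i)).verts) = ((I.biUnion Y : Finset V) : Set V) := by
      ext v
      simp only [Set.mem_iUnion, Finset.coe_biUnion, Finset.mem_coe, exists_prop]
      constructor
      · rintro ⟨i, hi⟩
        rw [hDv _ (f i).2] at hi
        exact ⟨f i, (f i).2, hi⟩
      · rintro ⟨i, hi, hv⟩
        refine ⟨f.symm ⟨i, hi⟩, ?_⟩
        rw [Equiv.apply_symm_apply, hDv i hi]
        exact hv
    rw [hverts, Set.ncard_coe_finset]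
    have h1 : ((Finset.univ \ I.biUnion Y).card : ℝ) + ((I.biUnion Y).card : ℝ) =
        Fintype.card V := by
      exact_mod_cast Finset.card_sdiff_add_card_eq_card (Finset.subset_univ (I.biUnion Y))
    have h2 : (N : ℝ) * ((Finset.univ \ I.biUnion Y).card : ℝ) ≤ Fintype.card V := by
      exact_mod_cast hU
    have h3 : 1 < η * N := by
      rw [div_lt_iff₀ hη] at hN
      linarith
    have h4 : ((Finset.univ \ I.biUnion Y).card : ℝ) ≤ η * Fintype.card V := by
      have h5 : (0 : ℝ) ≤ ((Finset.univ \ I.biUnion Y).card : ℝ) := by positivity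
      nlinarith
    linarith
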